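/- Let $\mathbb T^3=(\mathbb R/2\pi\mathbb Z)^3$, and fix $\Omega,\beta,\eta,\kappa>0$ and $\gamma\in(0,1/2)$. Consider the fractionally diffusive magneto-geostrophic (MG) equation for a real scalar $\Theta(t,x)$, $$\partial_t\Theta+U\cdot\nabla\Theta+\kappa(-\Delta)^\gamma\Theta=S,\qquad \nabla\cdot U=0,\qquad U_j=M_j\Theta\quad(j=1,2,3),$$ where $M_j$ are the Fourier multipliers with symbols, for $k\in\mathbb Z^3$ with $k_3\ne0$, $$\hat M_1=\frac{2\Omega k_2k_3|k|^2-\frac{\beta^2}{\eta}k_1k_2^2k_3}{D(k)},\quad \hat M_2=\frac{-2\Omega k_1k_3|k|^2-\frac{\beta^2}{\eta}k_2^3k_3}{D(k)},\quad \hat M_3=\frac{\frac{\beta^2}{\eta}k_2^2(k_1^2+k_2^2)}{D(k)},$$ $$D(k)=4\Omega^2k_3^2|k|^2+\Big(\frac{\beta^2}{\eta}\Big)^2k_2^4,$$ and $\hat M_j(k)=0$ if $k_3=0$. Let $Y\subset X\subset W^{1,4}(\mathbb T^3)$ be Banach spaces with continuous embeddings. The Cauchy problem with force $S$ is called locally Lipschitz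 $(X,Y)$ well-posed if there are continuous functions $T,K:[0,\infty)^2\to(0,\infty)$ such that for every pair of initial data $\Theta^{(1)}_0,\Theta^{(2)}_0\in Y$, with $T=T(\|\Theta^{(1)}_0\|_Y,\|\Theta^{(2)}_0\|_Y)$ and $K=K(\|\Theta^{(1)}_0\|_Y,\|\Theta^{(2)}_0\|_Y)$, there exist unique solutions $\Theta^{(1)},\Theta^{(2)}\in L^\infty(0,T;X)$ with these initial data (in the sense of distributions, and taken in their weakly continuous representatives), and $$\|\Theta^{(1)}(t)-\Theta^{(2)}(t)\|_X\le K\,\|\Theta^{(1)}_0-\Theta^{(2)}_0\|_Y\qquad\text{for every }t\in[0,T].$$ **Theorem (nonlinear ill-posedness).** Let $Y\subset X$ be Sobolev spaces on $\mathbb T^3$ embedded in $W^{1,4}(\mathbb T^3)$, or more generally any Banach spaces with continuous embeddings $Y\subset X\subset W^{1,4}(\mathbb T^3)$ such that $Y$ contains every $f\in C^\infty(\mathbb T^3)$ with zero vertical mean ($\hat f(k)=0$ whenever $k_3=0$). Let $a>0$, let $m\ge1$ be an integer, and let $S=\kappa a m^{2\gamma}\sin(mx_3)$, the time-independent force for which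 $a\sin(mx_3)$ is a steady state. Then the Cauchy problem for the MG equation with force $S$ is not locally Lipschitz $(X,Y)$ well-posed. -/

import Mathlib

open MeasureTheory Set
open scoped ENNReal NNReal

noncomputable section

namespace MG

/-- The torus `𝕋³`. A point `y ∈ (ℝ/ℤ)³` stands for the point `x = 2πy` of `(ℝ/2πℤ)³`, so that
`UnitAddTorus.mFourier k` is the function `exp (i k·x)` and `∂/∂x_j` has the symbol `i k_j`.
The coordinates `x₁, x₂, x₃` have the indices `0, 1, 2`. -/
abbrev T3 : Type := UnitAddTorus (Fin 3)

/-- Lebesgue measure on `𝕋³`, normalised to total mass one. -/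
def vol : Measure T3 := Measure.pi fun _ => AddCircle.haarAddCircle

instance : IsProbabilityMeasure vol := by
  unfold vol; infer_instance

instance : Fact ((1 : ℝ≥0∞) ≤ 4) := ⟨by norm_num⟩

/-- The Fourier coefficient `∫ exp (-i k·x) f(x) dx` of a real function on `𝕋³`. -/
def fc (f : T3 → ℝ) (k : Fin 3 → ℤ) : ℂ :=
  ∫ x, UnitAddTorus.mFourier (-k) x * (f x : ℂ) ∂vol

/-- `g` is the weak partial derivative `∂_j f` of `f`, tested against the functions
`exp (-i k·x)`, whose linear span is dense in `C^∞(𝕋³)`. -/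
def IsWeakDeriv (j : Fin 3) (f g : T3 → ℝ) : Prop :=
  ∀ k : Fin 3 → ℤ, fc g k = Complex.I * (k j : ℂ) * fc f k

lemma integrable_mFourier_mul {f : T3 → ℝ} (hf : Integrable f vol) (k : Fin 3 → ℤ) :
    Integrable (fun x => UnitAddTorus.mFourier (-k) x * (f x : ℂ)) vol := by
  refine Integrable.bdd_mul (c := 1) hf.ofReal
    (UnitAddTorus.mFourier (-k)).continuous.aestronglyMeasurable ?_
  refine Filter.Eventually.of_forall fun x => ?_
  exact ((UnitAddTorus.mFourier (-k)).norm_coe_le_norm x).trans UnitAddTorus.mFourier_norm.le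

lemma integrable_coe (f : Lp ℝ 4 vol) : Integrable f vol :=
  (Lp.memLp f).integrable (by norm_num)

lemma fc_coe_add (f g : Lp ℝ 4 vol) (k : Fin 3 → ℤ) :
    fc (f + g : Lp ℝ 4 vol) k = fc f k + fc g k := by
  unfold fc
  rw [← integral_add (integrable_mFourier_mul (integrable_coe f) k)
    (integrable_mFourier_mul (integrable_coe g) k)]
  refine integral_congr_ae ?_
  filter_upwards [Lp.coeFn_add f g] with x hx
  rw [hx, Pi.add_apply]
  push_cast
  ring

lemma fc_coe_smul (c : ℝ) (f : Lp ℝ 4 vol) (k : Fin 3 → ℤ) :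
    fc (c • f : Lp ℝ 4 vol) k = (c : ℂ) * fc f k := by
  unfold fc
  rw [← integral_const_mul]
  refine integral_congr_ae ?_
  filter_upwards [Lp.coeFn_smul c f] with x hx
  rw [hx, Pi.smul_apply, smul_eq_mul]
  push_cast
  ring

lemma fc_coe_zero (k : Fin 3 → ℤ) : fc (0 : Lp ℝ 4 vol) k = 0 := by
  have h := fc_coe_smul 0 0 k
  simpa using h

/-- The Sobolev space `W^{1,4}(𝕋³)` of real functions: an element is a function `f ∈ L⁴` together
with its weak gradient `(∂₁f, ∂₂f, ∂₃f) ∈ (L⁴)³` (which `f` determines). The norm, the largest of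
the four `L⁴` norms, is equivalent to the usual one. -/
def W14 : Submodule ℝ (Lp ℝ 4 vol × (Fin 3 → Lp ℝ 4 vol)) where
  carrier := {u | ∀ j, IsWeakDeriv j u.1 (u.2 j)}
  add_mem' := by
    intro u v hu hv j k
    have h1 := hu j k
    have h2 := hv j k
    simp only [Prod.fst_add, Prod.snd_add, Pi.add_apply]
    rw [fc_coe_add, fc_coe_add, h1, h2]
    ring
  zero_mem' := by
    intro j k
    simp only [Prod.fst_zero, Prod.snd_zero, Pi.zero_apply]
    rw [fc_coe_zero, mul_zero]
  smul_mem' := by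
    intro c u hu j k
    have h1 := hu j k
    simp only [Prod.smul_fst, Prod.smul_snd, Pi.smul_apply]
    rw [fc_coe_smul, fc_coe_smul, h1]
    ring

/-- The function underlying an element of `W^{1,4}`. -/
def W14.fn (u : W14) : T3 → ℝ := (u.1.1 : Lp ℝ 4 vol)

/-- The weak derivative `∂_j u` of an element of `W^{1,4}`. -/
def W14.deriv (u : W14) (j : Fin 3) : T3 → ℝ := (u.1.2 j : Lp ℝ 4 vol)

/-- Membership of an integrable function in `C^∞(𝕋³)` (after modification on a null set), expressed
as usual on the torus by rapid decay of the Fourier coefficients. -/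
def IsSmooth (f : T3 → ℝ) : Prop :=
  ∀ N : ℕ, ∃ C : ℝ, ∀ k : Fin 3 → ℤ, (1 + ∑ j, (k j : ℝ) ^ 2) ^ N * ‖fc f k‖ ≤ C

/-- `∫ f dx₃ = 0` for almost all `(x₁, x₂)`. -/
def HasZeroVerticalMean (f : T3 → ℝ) : Prop :=
  ∀ k : Fin 3 → ℤ, k 2 = 0 → fc f k = 0

/-- `|k|²`. -/
def normSq (k : Fin 3 → ℤ) : ℝ := ∑ j, (k j : ℝ) ^ 2

/-- The common denominator `4Ω² k₃² |k|² + (β²/η)² k₂⁴` of the symbols of `M`. -/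
def symbolDenom (Ω β η : ℝ) (k : Fin 3 → ℤ) : ℝ :=
  4 * Ω ^ 2 * (k 2 : ℝ) ^ 2 * normSq k + (β ^ 2 / η) ^ 2 * (k 1 : ℝ) ^ 4

/-- The symbols of the Fourier multipliers `M₁, M₂, M₃` that give the velocity. On `k₃ = 0`,
where the formulas are not used, the symbols are zero: the velocity has zero vertical mean. -/
def symbolM (Ω β η : ℝ) (j : Fin 3) (k : Fin 3 → ℤ) : ℝ :=
  if k 2 = 0 then 0 else
    ![2 * Ω * k 1 * k 2 * normSq k - (β ^ 2 / η) * k 0 * (k 1) ^ 2 * k 2,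
      -2 * Ω * k 0 * k 2 * normSq k - (β ^ 2 / η) * (k 1) ^ 3 * k 2,
      (β ^ 2 / η) * (k 1) ^ 2 * ((k 0) ^ 2 + (k 1) ^ 2)] j / symbolDenom Ω β η k

/-- `U = M[θ]` with `U_j ∈ L²(𝕋³)`, and `∇·U = 0`. -/
structure IsVelocity (Ω β η : ℝ) (θ : T3 → ℝ) (U : Fin 3 → Lp ℝ 2 vol) : Prop where
  constitutive : ∀ j k, fc (U j) k = (symbolM Ω β η j k : ℂ) * fc θ k
  divFree : ∀ k : Fin 3 → ℤ, ∑ j, Complex.I * (k j : ℂ) * fc (U j) k = 0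

/-- The symbol `|k|^{2γ}` of the fractional Laplacian `(-Δ)^γ`. -/
def symbolFracLaplacian (γ : ℝ) (k : Fin 3 → ℤ) : ℝ := normSq k ^ γ

section Nonlinear

variable {X Y : Type*} [NormedAddCommGroup X] [NormedSpace ℝ X]
  [NormedAddCommGroup Y] [NormedSpace ℝ Y]

/-- `Θ ∈ L^∞(0,T;X)` is a solution on `[0,T]` of
`∂ₜΘ + U·∇Θ + κ(-Δ)^γ Θ = S`, `∇·U = 0`, `U_j = M_j Θ`, `Θ(0,·) = φ`,
where `J : X → W^{1,4}` is the embedding. The equation is taken in the sense of distributions: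
it is tested against all `exp (-i k·x)` and integrated in time, for the representative of `Θ` that
is weakly continuous in time and hence defined for every `t ∈ [0,T]`. -/
structure IsSolution (Ω β η κ γ : ℝ) (S : ℝ → T3 → ℝ) (J : X →L[ℝ] W14)
    (T : ℝ) (φ : X) (Θ : ℝ → X) : Prop where
  measurable : AEStronglyMeasurable Θ (volume.restrict (Icc 0 T))
  bounded : ∃ C : ℝ, ∀ t ∈ Icc 0 T, ‖Θ t‖ ≤ C
  equation : ∃ U : ℝ → Fin 3 → Lp ℝ 2 vol,
    (∀ t ∈ Icc 0 T, IsVelocity Ω β η (W14.fn (J (Θ t))) (U t)) ∧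
    ∀ t ∈ Icc 0 T, ∀ k : Fin 3 → ℤ,
      fc (W14.fn (J (Θ t))) k = fc (W14.fn (J φ)) k +
        ∫ s in (0 : ℝ)..t,
          (fc (S s) k - fc (fun x => ∑ j, U s j x * W14.deriv (J (Θ s)) j x) k
            - (κ * symbolFracLaplacian γ k : ℝ) * fc (W14.fn (J (Θ s))) k)

/-- `Θ` is the unique solution in `L^∞(0,T;X)` on `[0,T]` with initial datum `φ`. -/
def IsUniqueSolution (Ω β η κ γ : ℝ) (S : ℝ → T3 → ℝ) (J : X →L[ℝ] W14)
    (T : ℝ) (φ : X) (Θ : ℝ → X) : Prop :=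
  IsSolution Ω β η κ γ S J T φ Θ ∧
    ∀ Θ' : ℝ → X, IsSolution Ω β η κ γ S J T φ Θ' → ∀ t ∈ Icc 0 T, Θ' t = Θ t

/-- Local Lipschitz `(X,Y)` well-posedness of the Cauchy problem with force `S`, for Banach spaces
`Y ⊂ X ⊂ W^{1,4}` with embeddings `i : Y → X` and `J : X → W^{1,4}`. -/
def LocallyLipschitzWellPosed (Ω β η κ γ : ℝ) (S : ℝ → T3 → ℝ)
    (J : X →L[ℝ] W14) (i : Y →L[ℝ] X) : Prop :=
  ∃ T K : ℝ≥0 × ℝ≥0 → ℝ, Continuous T ∧ Continuous K ∧ (∀ r, 0 < T r) ∧ (∀ r, 0 < K r) ∧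
    ∀ φ₁ φ₂ : Y, ∃ Θ₁ Θ₂ : ℝ → X,
      IsUniqueSolution Ω β η κ γ S J (T (‖φ₁‖₊, ‖φ₂‖₊)) (i φ₁) Θ₁ ∧
      IsUniqueSolution Ω β η κ γ S J (T (‖φ₁‖₊, ‖φ₂‖₊)) (i φ₂) Θ₂ ∧
      ∀ t ∈ Icc 0 (T (‖φ₁‖₊, ‖φ₂‖₊)), ‖Θ₁ t - Θ₂ t‖ ≤ K (‖φ₁‖₊, ‖φ₂‖₊) * ‖φ₁ - φ₂‖

end Nonlinear

/-- The profile `a sin (m x₃)`. -/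
def sinProfile (a : ℝ) (m : ℕ) : T3 → ℝ := fun x => a * (fourier (m : ℤ) (x 2) : ℂ).im

end MG

end

namespace MG

open UnitAddTorus ComplexConjugate Filter Topology

/-! The steady state `a sin (m x₃)` is linearly unstable with unbounded growth rates. Linearising
there couples the frequency `k` only to `k ± m e₃`, with strength `a m / 2` times the symbol `M₃`,
so each horizontal frequency `(k₁, k₂)` gives a scalar three-term recurrence in `k₃`. On the
parabola `k₁ = k₂²`, with `k₂ = x`, the symbol `M₃` is of size `x²` for bounded `k₃ ≠ 0`, while the
dissipation is of size `x^{4γ}`, which is smaller because `γ < 1/2`. Each far sector therefore has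
an eigenvalue at least `s x²`, with `s > 0` independent of `x` (`exists_jacobi_eigenvector`,
`exists_eigenvector`).

Lipschitz dependence on the data excludes this. Perturb the steady state by `ε y` and divide the
difference of the two solutions by `ε`: the quotient stays bounded by some `V` on a fixed interval
`[0, τ]`, and it solves the linearised equation up to an error of order `ε`, since the nonlinearity
is quadratic (`LocallyLipschitzWellPosed.exists_approx_linearized`). No limit `ε → 0` is taken.

Such approximate solutions are paired with the positive eigenvector of the transposed recurrence,
with alternating signs. The pairing satisfies `y' = σ y` up to a small error, so it grows like `exp
(σ τ)` (`exp_mul_le_of_approx`). One smooth datum has amplitude `exp (-x)` in every sector at once,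
hence `exp (s τ x²) exp (-x) ≤ 2 V` for all large `x`, which is false. -/

/-! ### Fourier coefficients: Parseval and products -/

lemma hasSum_conj_coeff_mul_coeff (f g : Lp ℂ 2 vol) :
    HasSum (fun k => conj (∫ x, mFourier (-k) x * f x ∂vol) * ∫ x, mFourier (-k) x * g x ∂vol)
      (∫ x, conj (f x) * g x ∂vol) :=
  hasSum_prod_mFourierCoeff f g

lemma integral_mFourier_neg_mul_mFourier (k l : Fin 3 → ℤ) :
    ∫ x, mFourier (-k) x * mFourier l x ∂vol = if k = l then 1 else 0 := by
  have h := orthonormal_iff_ite.mp (orthonormal_mFourier (d := Fin 3)) k l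
  rw [ContinuousMap.inner_toLp] at h
  rw [← h]
  refine integral_congr_ae (Eventually.of_forall fun x => ?_)
  simp only [mFourier_neg]
  ring

lemma fc_congr_ae {f g : T3 → ℝ} (h : f =ᵐ[vol] g) (k : Fin 3 → ℤ) : fc f k = fc g k := by
  refine integral_congr_ae ?_
  filter_upwards [h] with x hx
  rw [hx]

/-- This is Parseval for the pair `exp (i k·x) f` and `g`: as `f` is real, conjugating the first
factor yields `exp (-i k·x) f g` under the integral. -/
lemma hasSum_fc_mul {f g : T3 → ℝ} (hf : MemLp f 2 vol) (hg : MemLp g 2 vol) (k : Fin 3 → ℤ) :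
    HasSum (fun l => fc f (k - l) * fc g l) (fc (fun x => f x * g x) k) := by
  have hf' : MemLp (fun x => mFourier k x * (f x : ℂ)) 2 vol := by
    have hf0 : MemLp (fun x => (f x : ℂ)) 2 vol := hf.ofReal
    refine MemLp.of_le hf0 ((mFourier k).continuous.aestronglyMeasurable.mul
      hf0.aestronglyMeasurable) (Eventually.of_forall fun x => ?_)
    rw [norm_mul]
    exact mul_le_of_le_one_left (norm_nonneg _)
      (((mFourier k).norm_coe_le_norm x).trans mFourier_norm.le)
  have hg' : MemLp (fun x => (g x : ℂ)) 2 vol := hg.ofReal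
  have h := hasSum_conj_coeff_mul_coeff (hf'.toLp _) (hg'.toLp _)
  have h1 : ∫ x, conj (hf'.toLp _ x) * hg'.toLp _ x ∂vol = fc (fun x => f x * g x) k := by
    refine integral_congr_ae ?_
    filter_upwards [hf'.coeFn_toLp, hg'.coeFn_toLp] with x h1 h2
    rw [h1, h2, map_mul, ← mFourier_neg, Complex.conj_ofReal]
    push_cast
    ring
  rw [h1] at h
  refine h.congr_fun fun l => ?_
  congr 1
  · rw [← integral_conj]
    refine integral_congr_ae ?_
    filter_upwards [hf'.coeFn_toLp] with x h1
    rw [h1, map_mul, map_mul, ← mFourier_neg, ← mFourier_neg, Complex.conj_ofReal, neg_neg,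
      ← mul_assoc, ← mFourier_add]
    congr 2
    congr 1
    abel
  · refine integral_congr_ae ?_
    filter_upwards [hg'.coeFn_toLp] with x h1
    rw [h1]

lemma fc_neg (f : T3 → ℝ) (k : Fin 3 → ℤ) : fc f (-k) = conj (fc f k) := by
  unfold fc
  rw [← integral_conj]
  refine integral_congr_ae (Eventually.of_forall fun x => ?_)
  simp [mFourier_neg]

lemma fc_zero_mul_self (f : T3 → ℝ) :
    fc (fun x => f x * f x) 0 = ((∫ x, f x ^ 2 ∂vol : ℝ) : ℂ) := by
  unfold fc
  rw [← integral_complex_ofReal]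
  refine integral_congr_ae (Eventually.of_forall fun x => ?_)
  simp only [neg_zero, mFourier_zero, ContinuousMap.one_apply, one_mul]
  push_cast
  ring

lemma hasSum_sq_norm_fc {f : T3 → ℝ} (hf : MemLp f 2 vol) :
    HasSum (fun k => ‖fc f k‖ ^ 2) (∫ x, f x ^ 2 ∂vol) := by
  have h := hasSum_fc_mul hf hf 0
  rw [fc_zero_mul_self] at h
  rw [← Complex.hasSum_ofReal]
  refine h.congr_fun fun l => ?_
  rw [zero_sub, fc_neg, Complex.conj_mul']
  push_cast
  rfl

lemma norm_fc_sq_le {f : T3 → ℝ} (hf : MemLp f 2 vol) (k : Fin 3 → ℤ) :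
    ‖fc f k‖ ^ 2 ≤ ∫ x, f x ^ 2 ∂vol :=
  le_hasSum (hasSum_sq_norm_fc hf) k fun _ _ => by positivity

lemma norm_fc_mul_le {f g : T3 → ℝ} (hf : MemLp f 2 vol) (hg : MemLp g 2 vol) (k : Fin 3 → ℤ) :
    ‖fc (fun x => f x * g x) k‖ ≤ (∫ x, f x ^ 2 ∂vol) + ∫ x, g x ^ 2 ∂vol := by
  rw [← integral_add hf.integrable_sq hg.integrable_sq]
  refine norm_integral_le_of_norm_le (hf.integrable_sq.add hg.integrable_sq)
    (Eventually.of_forall fun x => ?_)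
  rw [norm_mul]
  refine (mul_le_of_le_one_left (norm_nonneg _)
      (((mFourier (-k)).norm_coe_le_norm x).trans mFourier_norm.le)).trans ?_
  rw [Complex.norm_real, Real.norm_eq_abs, abs_le]
  constructor <;> nlinarith [sq_nonneg (f x + g x), sq_nonneg (f x - g x)]

lemma fc_add {f g : T3 → ℝ} (hf : Integrable f vol) (hg : Integrable g vol) (k : Fin 3 → ℤ) :
    fc (fun x => f x + g x) k = fc f k + fc g k := by
  unfold fc
  rw [← integral_add (integrable_mFourier_mul hf k) (integrable_mFourier_mul hg k)]
  refine integral_congr_ae (Eventually.of_forall fun x => ?_)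
  push_cast
  ring

lemma fc_sum {ι : Type*} (s : Finset ι) {f : ι → T3 → ℝ} (hf : ∀ j ∈ s, Integrable (f j) vol)
    (k : Fin 3 → ℤ) : fc (fun x => ∑ j ∈ s, f j x) k = ∑ j ∈ s, fc (f j) k := by
  unfold fc
  rw [← integral_finsetSum s fun j hj => integrable_mFourier_mul (hf j hj) k]
  refine integral_congr_ae (Eventually.of_forall fun x => ?_)
  push_cast
  simp only [Finset.mul_sum]

/-! ### Quantities controlled by the `W^{1,4}` norm -/

lemma memLp_two_coe (f : Lp ℝ 4 vol) : MemLp f 2 vol :=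
  (Lp.memLp f).mono_exponent (by norm_num)

lemma integral_sq_le (f : Lp ℝ 4 vol) : ∫ x, f x ^ 2 ∂vol ≤ ‖f‖ ^ 2 := by
  have h2 := memLp_two_coe f
  have h3 : ∫ x, f x ^ 2 ∂vol = ‖h2.toLp‖ ^ 2 := by
    rw [← real_inner_self_eq_norm_sq, L2.inner_def]
    refine integral_congr_ae ?_
    filter_upwards [h2.coeFn_toLp] with x hx
    simp only [hx, RCLike.inner_apply, conj_trivial, sq]
  rw [h3]
  gcongr
  rw [Lp.norm_toLp, Lp.norm_def]
  refine ENNReal.toReal_mono (Lp.eLpNorm_ne_top f) ?_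
  exact eLpNorm_le_eLpNorm_of_exponent_le (by norm_num) (Lp.aestronglyMeasurable f)

lemma W14.norm_fst_le (u : W14) : ‖u.1.1‖ ≤ ‖u‖ := _root_.norm_fst_le u.1

lemma W14.norm_snd_le (u : W14) (j : Fin 3) : ‖u.1.2 j‖ ≤ ‖u‖ :=
  (norm_le_pi_norm u.1.2 j).trans (_root_.norm_snd_le u.1)

lemma W14.memLp_fn (u : W14) : MemLp (W14.fn u) 2 vol := memLp_two_coe _

lemma W14.memLp_deriv (u : W14) (j : Fin 3) : MemLp (W14.deriv u j) 2 vol := memLp_two_coe _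

lemma W14.integral_fn_sq_le (u : W14) : ∫ x, W14.fn u x ^ 2 ∂vol ≤ ‖u‖ ^ 2 :=
  (integral_sq_le _).trans (by gcongr; exact W14.norm_fst_le u)

lemma W14.integral_deriv_sq_le (u : W14) (j : Fin 3) :
    ∫ x, W14.deriv u j x ^ 2 ∂vol ≤ ‖u‖ ^ 2 :=
  (integral_sq_le _).trans (by gcongr; exact W14.norm_snd_le u j)

lemma W14.norm_fc_fn_le (u : W14) (k : Fin 3 → ℤ) : ‖fc (W14.fn u) k‖ ≤ ‖u‖ :=
  le_of_sq_le_sq ((norm_fc_sq_le (W14.memLp_fn u) k).trans (W14.integral_fn_sq_le u)) (norm_nonneg _)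

lemma W14.fc_deriv (u : W14) (j : Fin 3) (k : Fin 3 → ℤ) :
    fc (W14.deriv u j) k = Complex.I * (k j : ℂ) * fc (W14.fn u) k := u.2 j k

lemma W14.fc_fn_add (u v : W14) (k : Fin 3 → ℤ) :
    fc (W14.fn (u + v)) k = fc (W14.fn u) k + fc (W14.fn v) k := fc_coe_add _ _ k

lemma W14.fc_fn_smul (c : ℝ) (u : W14) (k : Fin 3 → ℤ) :
    fc (W14.fn (c • u)) k = (c : ℂ) * fc (W14.fn u) k := fc_coe_smul _ _ k

/-- The Fourier coefficient as a continuous linear functional on `W^{1,4}`. -/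
noncomputable def fcL (k : Fin 3 → ℤ) : W14 →L[ℝ] ℂ :=
  LinearMap.mkContinuous
    { toFun := fun u => fc (W14.fn u) k
      map_add' := fun u v => W14.fc_fn_add u v k
      map_smul' := fun c u => by
        rw [W14.fc_fn_smul, RingHom.id_apply, Complex.real_smul] } 1
    fun u => by rw [one_mul]; exact W14.norm_fc_fn_le u k

/-! ### The multipliers have order at most one -/

section Symbols

variable {Ω β η : ℝ}

/-- The denominator is a sum `A + B`. Each term of a numerator is absorbed either by `A ≤ A + B` or
by `4 A B ≤ (A + B)²`; missing factors `k₃²` and `|k|²` are supplied by `1 ≤ k₃² ≤ |k|²`. -/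
lemma sq_symbolM_le (hΩ : 0 < Ω) (hβ : 0 < β) (hη : 0 < η) (j : Fin 3) (k : Fin 3 → ℤ) :
    symbolM Ω β η j k ^ 2 ≤ 3 / (4 * Ω ^ 2) * normSq k := by
  have hb : 0 < β ^ 2 / η := by positivity
  unfold symbolM symbolDenom
  generalize β ^ 2 / η = b at hb
  have hq : normSq k = (k 0 : ℝ) ^ 2 + (k 1 : ℝ) ^ 2 + (k 2 : ℝ) ^ 2 := by
    simp [normSq, Fin.sum_univ_three]
  split_ifs with h
  · have : 0 ≤ normSq k := by rw [hq]; positivity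
    simp only [ne_eq, OfNat.ofNat_ne_zero, not_false_eq_true, zero_pow]
    positivity
  have hz : (1 : ℝ) ≤ (k 2 : ℝ) ^ 2 := by
    rw [one_le_sq_iff_one_le_abs]
    exact_mod_cast Int.one_le_abs h
  generalize normSq k = q at *
  generalize (k 0 : ℝ) = x at *
  generalize (k 1 : ℝ) = y at *
  generalize (k 2 : ℝ) = z at *
  have hx2 : x ^ 2 ≤ q := by nlinarith [sq_nonneg y, sq_nonneg z]
  have hy2 : y ^ 2 ≤ q := by nlinarith [sq_nonneg x, sq_nonneg z]
  have hxy2 : x ^ 2 + y ^ 2 ≤ q := by nlinarith [sq_nonneg z]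
  have hz2 : z ^ 2 ≤ q := by nlinarith [sq_nonneg y, sq_nonneg x]
  have hq1 : 1 ≤ q := hz.trans hz2
  set D := 4 * Ω ^ 2 * z ^ 2 * q + b ^ 2 * y ^ 4 with hD
  have hDpos : 0 < D := by positivity
  have hD1 : 4 * Ω ^ 2 * z ^ 2 * q ≤ D := by rw [hD]; nlinarith [show 0 ≤ b ^ 2 * y ^ 4 by positivity]
  have hD2 : 4 * (4 * Ω ^ 2 * z ^ 2 * q) * (b ^ 2 * y ^ 4) ≤ D ^ 2 := by
    rw [hD]; nlinarith [sq_nonneg (4 * Ω ^ 2 * z ^ 2 * q - b ^ 2 * y ^ 4)]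
  have hD3 : (4 * Ω ^ 2 * z ^ 2 * q) ^ 2 ≤ D ^ 2 := by gcongr
  have key1 : ∀ w : ℝ, w ^ 2 ≤ q → 4 * Ω ^ 2 * ((2 * Ω * w * z * q) ^ 2) ≤ q * D ^ 2 := by
    intro w hw
    calc 4 * Ω ^ 2 * ((2 * Ω * w * z * q) ^ 2) = (16 * Ω ^ 4 * z ^ 2 * q ^ 2) * w ^ 2 := by ring
      _ ≤ (16 * Ω ^ 4 * z ^ 2 * q ^ 2) * q := by gcongr
      _ ≤ (16 * Ω ^ 4 * z ^ 2 * q ^ 2) * q * z ^ 2 := le_mul_of_one_le_right (by positivity) hz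
      _ = q * (4 * Ω ^ 2 * z ^ 2 * q) ^ 2 := by ring
      _ ≤ q * D ^ 2 := by gcongr
  have key2 : ∀ w : ℝ, w ^ 2 ≤ q → 4 * Ω ^ 2 * ((b * w * y ^ 2 * z) ^ 2) * 4 ≤ q * D ^ 2 := by
    intro w hw
    calc 4 * Ω ^ 2 * ((b * w * y ^ 2 * z) ^ 2) * 4
        = 4 * (4 * Ω ^ 2 * z ^ 2) * (b ^ 2 * y ^ 4) * w ^ 2 := by ring
      _ ≤ 4 * (4 * Ω ^ 2 * z ^ 2) * (b ^ 2 * y ^ 4) * q := by gcongr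
      _ = 4 * (4 * Ω ^ 2 * z ^ 2 * q) * (b ^ 2 * y ^ 4) := by ring
      _ ≤ D ^ 2 := hD2
      _ ≤ q * D ^ 2 := le_mul_of_one_le_left (by positivity) hq1
  have key3 : 4 * Ω ^ 2 * ((b * y ^ 2 * (x ^ 2 + y ^ 2)) ^ 2) * 4 ≤ q * D ^ 2 := by
    calc 4 * Ω ^ 2 * ((b * y ^ 2 * (x ^ 2 + y ^ 2)) ^ 2) * 4
        = 16 * Ω ^ 2 * (b ^ 2 * y ^ 4) * (x ^ 2 + y ^ 2) ^ 2 := by ring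
      _ ≤ 16 * Ω ^ 2 * (b ^ 2 * y ^ 4) * q ^ 2 := by gcongr
      _ ≤ 16 * Ω ^ 2 * (b ^ 2 * y ^ 4) * q ^ 2 * z ^ 2 := le_mul_of_one_le_right (by positivity) hz
      _ = q * (4 * (4 * Ω ^ 2 * z ^ 2 * q) * (b ^ 2 * y ^ 4)) := by ring
      _ ≤ q * D ^ 2 := by gcongr
  have goal : ∀ s : ℝ, 4 * Ω ^ 2 * s ^ 2 ≤ 3 * (q * D ^ 2) →
      (s / D) ^ 2 ≤ 3 / (4 * Ω ^ 2) * q := by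
    intro s hs
    rw [div_pow, div_mul_eq_mul_div, div_le_div_iff₀ (by positivity) (by positivity)]
    nlinarith
  have hqD : 0 ≤ q * D ^ 2 := by positivity
  fin_cases j
  · refine goal _ ?_
    have h1 := key1 y hy2
    have h2 := key2 x hx2
    simp only [Fin.zero_eta, Matrix.cons_val_zero]
    nlinarith [mul_nonneg (sq_nonneg Ω) (sq_nonneg (2 * Ω * y * z * q + b * x * y ^ 2 * z))]
  · refine goal _ ?_
    have h1 := key1 x hx2
    have h2 := key2 y hy2
    simp only [Fin.mk_one, Matrix.cons_val_one]
    rw [show -2 * Ω * x * z * q - b * y ^ 3 * z = -(2 * Ω * x * z * q + b * y * y ^ 2 * z) by ring]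
    have h3 := mul_nonneg (sq_nonneg Ω) (sq_nonneg (2 * Ω * x * z * q - b * y * y ^ 2 * z))
    simp only [Matrix.cons_val_zero]
    nlinarith
  · refine goal _ ?_
    have h1 : 0 ≤ 4 * Ω ^ 2 * ((b * y ^ 2 * (x ^ 2 + y ^ 2)) ^ 2) := by positivity
    simp only [Fin.reduceFinMk, Matrix.cons_val]
    linarith

/-- A symbol of order one costs one derivative, so by Parseval the velocity is bounded in `L²` by
the gradient of `w`; the constant 9 is 3 from the symbol times the 3 partial derivatives. -/
lemma integral_sq_velocity_le (hΩ : 0 < Ω) (hβ : 0 < β) (hη : 0 < η) {w : W14}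
    {U : Fin 3 → Lp ℝ 2 vol} (hU : IsVelocity Ω β η (W14.fn w) U) (j : Fin 3) :
    ∫ x, U j x ^ 2 ∂vol ≤ 9 / (4 * Ω ^ 2) * ‖w‖ ^ 2 := by
  have h1 := hasSum_sq_norm_fc (Lp.memLp (U j))
  have h2 := (hasSum_sum fun i (_ : i ∈ Finset.univ) =>
    hasSum_sq_norm_fc (W14.memLp_deriv w i)).mul_left (3 / (4 * Ω ^ 2))
  refine (hasSum_le (fun k => ?_) h1 h2).trans ?_
  · rw [hU.constitutive j k, norm_mul, mul_pow, Complex.norm_real, Real.norm_eq_abs, sq_abs]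
    simp only [W14.fc_deriv, norm_mul, mul_pow, Complex.norm_I, one_mul,
      Complex.norm_intCast, sq_abs]
    rw [← Finset.sum_mul, ← mul_assoc]
    gcongr
    exact sq_symbolM_le hΩ hβ hη j k
  · calc 3 / (4 * Ω ^ 2) * ∑ i, ∫ x, W14.deriv w i x ^ 2 ∂vol
        ≤ 3 / (4 * Ω ^ 2) * ∑ _i : Fin 3, ‖w‖ ^ 2 := by
          gcongr with i; exact W14.integral_deriv_sq_le w i
      _ = 9 / (4 * Ω ^ 2) * ‖w‖ ^ 2 := by simp; ring

end Symbols

/-! ### Positive decaying eigenvectors of half-line Jacobi recurrences, by shooting -/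

/-- The solution of `r (n + 2) = a n * r (n + 1) - r n`, `r 0 = 0`, `r 1 = 1`. -/
def jacobiSeq (a : ℕ → ℝ) : ℕ → ℝ
  | 0 => 0
  | 1 => 1
  | n + 2 => a n * jacobiSeq a (n + 1) - jacobiSeq a n

lemma continuous_jacobiSeq {a : ℝ → ℕ → ℝ} (ha : ∀ n, Continuous fun s => a s n) (n : ℕ) :
    Continuous fun s => jacobiSeq (a s) n := by
  induction n using Nat.twoStepInduction with
  | zero => simpa [jacobiSeq] using continuous_const
  | one => simpa [jacobiSeq] using continuous_const
  | more n h1 h2 => exact ((ha n).mul h2).sub h1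

/-- With coefficients at least 2 the sequence is convex as long as it is nonnegative, so one
increase propagates forever. -/
lemma jacobiSeq_pos_of_lt {a : ℕ → ℝ} {n : ℕ} (ha : ∀ i ≥ n, 2 ≤ a i)
    (hpos : 0 ≤ jacobiSeq a n) (hlt : jacobiSeq a n < jacobiSeq a (n + 1)) (i : ℕ) (hi : n ≤ i) :
    0 ≤ jacobiSeq a i ∧ jacobiSeq a i < jacobiSeq a (i + 1) := by
  induction i, hi using Nat.le_induction with
  | base => exact ⟨hpos, hlt⟩
  | succ i hi ih =>
    obtain ⟨h1, h2⟩ := ih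
    refine ⟨h1.trans h2.le, ?_⟩
    have h3 := ha i hi
    simp only [jacobiSeq]
    nlinarith

/-- A positive, eventually decaying solution of the eigenvalue problem of a half-line Jacobi
operator, with an eigenvalue above `σ₀`. -/
theorem exists_jacobi_eigenvector {a : ℝ → ℕ → ℝ} (hcont : ∀ n, Continuous fun s => a s n)
    {σ₀ σ₁ : ℝ} (h01 : σ₀ ≤ σ₁) (h0 : a σ₀ 0 ≤ 1) (h0' : 0 ≤ a σ₀ 0) (h1 : a σ₀ 1 ≤ 1)
    (h2 : ∀ n, 2 ≤ a σ₁ n) {n₀ : ℕ} (h3 : ∀ s ≥ σ₀, ∀ n ≥ n₀, 3 ≤ a s n) :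
    ∃ σ ≥ σ₀, (∀ n, 0 < jacobiSeq (a σ) (n + 1)) ∧
      ∀ n ≥ n₀, jacobiSeq (a σ) (n + 1) ≤ jacobiSeq (a σ) n / 2 := by
  -- Shooting: large parameters keep the sequence positive, and the threshold value `sInf G` is the
  -- one at which it decays.
  set G : Set ℝ := {s | σ₀ ≤ s ∧ ∀ n, 0 < jacobiSeq (a s) (n + 1)} with hG
  have hne : σ₁ ∈ G := by
    refine ⟨h01, fun n => ?_⟩
    have h := jacobiSeq_pos_of_lt (a := a σ₁) (n := 0) (fun i _ => h2 i) (by simp [jacobiSeq])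
      (by simp [jacobiSeq]) n (Nat.zero_le n)
    exact h.1.trans_lt h.2
  have hbdd : BddBelow G := ⟨σ₀, fun s hs => hs.1⟩
  set σ := sInf G with hσ
  have hσ₀ : σ₀ ≤ σ := le_csInf ⟨_, hne⟩ fun s hs => hs.1
  have hcl : σ ∈ closure G := csInf_mem_closure ⟨_, hne⟩ hbdd
  have hnn : ∀ n, 0 ≤ jacobiSeq (a σ) (n + 1) := by
    intro n
    have hclosed : IsClosed {s | 0 ≤ jacobiSeq (a s) (n + 1)} :=
      isClosed_le continuous_const (continuous_jacobiSeq hcont _)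
    exact closure_minimal (fun s hs => (hs.2 n).le) hclosed hcl
  have hpos : ∀ n, 0 < jacobiSeq (a σ) (n + 1) := by
    intro n
    induction n with
    | zero => simp [jacobiSeq]
    | succ n ih =>
      -- A zero directly after a positive term would make the next term negative.
      refine (hnn (n + 1)).lt_of_ne fun h => ?_
      have h4 := hnn (n + 2)
      simp only [jacobiSeq] at h h4 ih
      rw [← h] at h4
      linarith
  have hlt : σ₀ < σ := by
    -- At `σ₀` the term of index 3 is `a 1 * a 0 - 1 ≤ 0`, so positivity fails there.
    refine hσ₀.lt_of_ne fun h => ?_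
    have h4 := hpos 2
    rw [← h] at h4
    simp only [jacobiSeq] at h4
    nlinarith
  have hdec : ∀ n ≥ n₀, jacobiSeq (a σ) (n + 1) ≤ jacobiSeq (a σ) n := by
    intro n hn
    -- An increase beyond `n₀` and the positivity of the finitely many terms before it are open
    -- conditions in the parameter. They survive slightly below `σ`, and convexity then gives
    -- positivity of all terms, against the minimality of `σ`.
    by_contra! hcon
    have hev : ∀ᶠ s in 𝓝 σ, (∀ i ∈ Finset.range (n + 1), 0 < jacobiSeq (a s) (i + 1)) ∧
        jacobiSeq (a s) n < jacobiSeq (a s) (n + 1) ∧ σ₀ < s := by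
      refine Filter.Eventually.and ?_ (Filter.Eventually.and ?_ (lt_mem_nhds hlt))
      · rw [Filter.eventually_all_finset]
        exact fun i _ => continuousAt_const.eventually_lt
          (continuous_jacobiSeq hcont _).continuousAt (hpos i)
      · exact (continuous_jacobiSeq hcont _).continuousAt.eventually_lt
          (continuous_jacobiSeq hcont _).continuousAt hcon
    obtain ⟨s, ⟨hs1, hs2, hs3⟩, hs4⟩ := (hev.filter_mono nhdsWithin_le_nhds |>.and
      (self_mem_nhdsWithin : Iio σ ∈ 𝓝[<] σ)).exists
    refine absurd (csInf_le hbdd (show s ∈ G from ⟨hs3.le, fun i => ?_⟩)) (not_le.2 hs4)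
    rcases lt_or_ge i (n + 1) with hi | hi
    · exact hs1 i (Finset.mem_range.2 hi)
    · have hnn' : 0 ≤ jacobiSeq (a s) n := by
        rcases n with _ | n
        · simp [jacobiSeq]
        · exact (hs1 n (Finset.mem_range.2 (by omega))).le
      have h := jacobiSeq_pos_of_lt (a := a s) (n := n)
        (fun i hi => by linarith [h3 s hs3.le i (hn.trans hi)]) hnn' hs2 i (by omega)
      exact h.1.trans_lt h.2
  refine ⟨σ, hσ₀, hpos, fun n hn => ?_⟩
  have h4 := h3 σ hσ₀ n hn
  have h5 := hdec (n + 1) (by omega)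
  have h6 := hpos n
  simp only [jacobiSeq] at h5
  nlinarith

/-- The eigenvector of the linearised operator on the modes `n ≥ 1`, where `M n` are the values of
the symbol and `δ n` the dissipation rates. -/
theorem exists_eigenvector {M δ : ℕ → ℝ} {c σ₀ Mmax : ℝ} {n₀ : ℕ} (hc : 0 < c)
    (hM : ∀ n, 1 ≤ n → 0 < M n) (hMmax : ∀ n, M n ≤ Mmax) (hδ : ∀ n, 0 ≤ δ n) (hσ₀ : 0 < σ₀)
    (h1 : σ₀ + δ 1 ≤ c * M 1) (h2 : σ₀ + δ 2 ≤ c * M 2) (hn₀ : ∀ n > n₀, 3 * (c * M n) ≤ σ₀) :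
    ∃ σ ≥ σ₀, ∃ r : ℕ → ℝ, r 0 = 0 ∧ (∀ n, 1 ≤ n → 0 < r n) ∧
      (∀ n, c * M (n + 1) * (r (n + 2) + r n) = (σ + δ (n + 1)) * r (n + 1)) ∧
      ∀ n ≥ n₀, r (n + 1) ≤ r n / 2 := by
  -- Dividing the eigenvalue equation by `c * M (n + 1)` gives the recurrence. The parameter `2 * (c
  -- * Mmax)` below makes all coefficients at least 2.
  set a : ℝ → ℕ → ℝ := fun s n => (s + δ (n + 1)) / (c * M (n + 1)) with ha
  have hcM : ∀ n, 0 < c * M (n + 1) := fun n => mul_pos hc (hM _ (by omega))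
  have hmax : c * M 1 ≤ c * Mmax := by gcongr; exact hMmax 1
  obtain ⟨σ, h3, h4, h5⟩ := exists_jacobi_eigenvector (a := a) (σ₀ := σ₀) (σ₁ := 2 * (c * Mmax))
    (n₀ := n₀) (fun n => by fun_prop) (by linarith [hδ 1, hcM 0])
    (by rw [ha]; exact (div_le_one (hcM 0)).2 h1)
    (div_nonneg (by linarith [hδ 1]) (hcM 0).le)
    (by rw [ha]; exact (div_le_one (hcM 1)).2 h2)
    (fun n => by
      rw [ha]
      refine (le_div_iff₀ (hcM n)).2 ?_
      have : c * M (n + 1) ≤ c * Mmax := by gcongr; exact hMmax _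
      linarith [hδ (n + 1)])
    (fun s hs n hn => by
      rw [ha]
      refine (le_div_iff₀ (hcM n)).2 ?_
      linarith [hδ (n + 1), hn₀ (n + 1) (by omega)])
  refine ⟨σ, h3, jacobiSeq (a σ), rfl, fun n hn => ?_, fun n => ?_, h5⟩
  · obtain ⟨n, rfl⟩ := Nat.exists_eq_add_of_le' hn
    exact h4 n
  · have : jacobiSeq (a σ) (n + 2) + jacobiSeq (a σ) n = a σ n * jacobiSeq (a σ) (n + 1) := by
      simp [jacobiSeq]
    rw [this, ← mul_assoc]
    congr 1
    exact mul_div_cancel₀ _ (hcM n).ne'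

/-! ### Growth of approximate solutions tested against an eigenvector -/

/-- Gronwall's inequality for an approximate solution of `y' = σ y` in integral form. -/
theorem norm_sub_exp_mul_le {y g : ℝ → ℂ} {y₀ : ℂ} {σ τ ε : ℝ} (hσ : 0 < σ) (hτ : 0 ≤ τ)
    (hg : IntegrableOn g (Icc 0 τ)) (hy : ∀ t ∈ Icc 0 τ, y t = y₀ + ∫ s in (0 : ℝ)..t, g s)
    (hε : ∀ s ∈ Icc 0 τ, ‖g s - σ * y s‖ ≤ ε) :
    ‖y τ - Real.exp (σ * τ) * y₀‖ ≤ ε * τ * Real.exp (σ * τ) := by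
  have hε0 : 0 ≤ ε := (norm_nonneg _).trans (hε 0 ⟨le_rfl, hτ⟩)
  have hycont : ContinuousOn y (Icc 0 τ) := by
    refine ContinuousOn.congr ?_ hy
    have h := intervalIntegral.continuousOn_primitive_interval (μ := volume) (f := g) (a := 0)
      (b := τ) (by rwa [uIcc_of_le hτ])
    rw [uIcc_of_le hτ] at h
    exact continuousOn_const.add h
  set h : ℝ → ℂ := fun t => Real.exp (σ * t) * y₀ with hh
  have hhcont : Continuous h := by fun_prop
  have hderiv : ∀ t, HasDerivAt h (σ * h t) t := by
    intro t
    have h1 : HasDerivAt (fun t : ℝ => Real.exp (σ * t)) (Real.exp (σ * t) * (σ * 1)) t :=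
      ((hasDerivAt_id t).const_mul σ).exp
    convert! (h1.ofReal_comp).mul_const y₀ using 1
    simp only [hh]
    push_cast
    ring
  have hhint : ∀ t, h t = y₀ + ∫ s in (0 : ℝ)..t, σ * h s := by
    intro t
    rw [intervalIntegral.integral_eq_sub_of_hasDerivAt (fun s _ => hderiv s)
      ((by fun_prop : Continuous fun s => (σ : ℂ) * h s).intervalIntegrable _ _)]
    simp [hh]
  set z : ℝ → ℝ := fun t => ‖y t - h t‖ with hz
  have hzcont : ContinuousOn z (Icc 0 τ) := (hycont.sub hhcont.continuousOn).norm
  have hzint : ∀ t ∈ Icc 0 τ, IntervalIntegrable z volume 0 t := fun t ht =>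
    (hzcont.mono (by rw [uIcc_of_le ht.1]; exact Icc_subset_Icc_right ht.2)).intervalIntegrable
  have hbound : ∀ t ∈ Icc 0 τ, z t ≤ σ * (∫ s in (0 : ℝ)..t, z s) + ε * τ := by
    intro t ht
    have hgi : IntervalIntegrable g volume 0 t := by
      rw [intervalIntegrable_iff_integrableOn_Icc_of_le ht.1]
      exact hg.mono_set (Icc_subset_Icc_right ht.2)
    have hhi : IntervalIntegrable (fun s => (σ : ℂ) * h s) volume 0 t :=
      (by fun_prop : Continuous fun s => (σ : ℂ) * h s).intervalIntegrable _ _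
    have h1 : y t - h t = ∫ s in (0 : ℝ)..t, (g s - σ * h s) := by
      rw [hy t ht, hhint t, intervalIntegral.integral_sub hgi hhi]
      ring
    have h2 : ‖y t - h t‖ ≤ ∫ s in (0 : ℝ)..t, (σ * z s + ε) := by
      rw [h1]
      refine intervalIntegral.norm_integral_le_of_norm_le ht.1
        (Eventually.of_forall fun s hs => ?_)
        (((hzint t ht).const_mul σ).add intervalIntegrable_const)
      have hs' : s ∈ Icc 0 τ := ⟨hs.1.le, hs.2.trans ht.2⟩
      calc ‖g s - σ * h s‖ = ‖(σ : ℂ) * (y s - h s) + (g s - σ * y s)‖ := by congr 1; ring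
        _ ≤ ‖(σ : ℂ) * (y s - h s)‖ + ‖g s - σ * y s‖ := norm_add_le _ _
        _ ≤ σ * z s + ε := by
          rw [norm_mul, Complex.norm_real, Real.norm_of_nonneg hσ.le]
          gcongr
          exact hε s hs'
    rw [intervalIntegral.integral_add ((hzint t ht).const_mul σ) intervalIntegrable_const,
      intervalIntegral.integral_const_mul, intervalIntegral.integral_const, smul_eq_mul,
      sub_zero] at h2
    refine h2.trans ?_
    rw [mul_comm t ε]
    gcongr
    exact ht.2
  -- Since `g` is only integrable, Gronwall is applied to the primitive `Z`, whose derivative `z` is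
  -- continuous; the bound on `Z τ` is then put back into `hbound`.
  set Z : ℝ → ℝ := fun t => ∫ s in (0 : ℝ)..t, z s with hZ
  have hZcont : ContinuousOn Z (Icc 0 τ) := by
    have h := intervalIntegral.continuousOn_primitive_interval (μ := volume) (f := z) (a := 0)
      (b := τ) (by rw [uIcc_of_le hτ]; exact hzcont.integrableOn_Icc)
    rwa [uIcc_of_le hτ] at h
  have hZderiv : ∀ t ∈ Ico 0 τ, HasDerivWithinAt Z (z t) (Ici t) t := by
    intro t ht
    have ht' : t ∈ Icc 0 τ := Ico_subset_Icc_self ht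
    have hmem : Icc 0 τ ∈ 𝓝[>] t := mem_of_superset (Ioo_mem_nhdsGT ht.2)
      fun s hs => ⟨ht.1.trans hs.1.le, hs.2.le⟩
    refine intervalIntegral.integral_hasDerivWithinAt_right (hzint t ht')
      ?_ ((hzcont t ht').mono_of_mem_nhdsWithin hmem)
    exact ⟨Icc 0 τ, hmem, hzcont.aestronglyMeasurable measurableSet_Icc⟩
  have hZnn : ∀ t ∈ Icc 0 τ, 0 ≤ Z t := fun t ht =>
    intervalIntegral.integral_nonneg ht.1 fun s _ => norm_nonneg _
  have hgron := norm_le_gronwallBound_of_norm_deriv_right_le (f := Z) (f' := z) (δ := 0) (K := σ)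
    (ε := ε * τ) (a := 0) (b := τ) hZcont hZderiv (by simp [hZ])
    (fun t ht => by
      rw [Real.norm_of_nonneg (norm_nonneg _), Real.norm_of_nonneg (hZnn t (Ico_subset_Icc_self ht))]
      exact hbound t (Ico_subset_Icc_self ht)) τ ⟨hτ, le_rfl⟩
  rw [Real.norm_of_nonneg (hZnn τ ⟨hτ, le_rfl⟩), gronwallBound_of_K_ne_0 hσ.ne'] at hgron
  simp only [sub_zero, zero_mul, zero_add] at hgron
  have hfin := hbound τ ⟨hτ, le_rfl⟩
  have : σ * (ε * τ / σ * (Real.exp (σ * τ) - 1)) = ε * τ * (Real.exp (σ * τ) - 1) := by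
    field_simp
  calc z τ ≤ σ * Z τ + ε * τ := hfin
    _ ≤ σ * (ε * τ / σ * (Real.exp (σ * τ) - 1)) + ε * τ := by gcongr
    _ = ε * τ * Real.exp (σ * τ) := by rw [this]; ring

/-- The modes up to `n₀` carry at least half of the total mass of `r`. The extra `r N` on the left
is the slack for the induction: halving gives `2 * r (N + 1) ≤ r N`. -/
lemma sum_le_of_halving {r : ℕ → ℝ} {n₀ : ℕ} (hn₀ : 1 ≤ n₀) (hr : ∀ n, 1 ≤ n → 0 < r n)
    (hdec : ∀ n ≥ n₀, r (n + 1) ≤ r n / 2) {N : ℕ} (hN : n₀ ≤ N) :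
    ∑ n ∈ Finset.range N, r (n + 1) + r N ≤ 2 * ∑ n ∈ Finset.range n₀, r (n + 1) := by
  induction N, hN using Nat.le_induction with
  | base =>
    obtain ⟨m, rfl⟩ := Nat.exists_eq_add_of_le' hn₀
    have := Finset.single_le_sum (f := fun n => r (n + 1)) (s := Finset.range (m + 1))
      (fun i _ => (hr _ (by omega)).le) (Finset.mem_range.2 (Nat.lt_succ_self m))
    linarith
  | succ N hN ih =>
    rw [Finset.sum_range_succ]
    linarith [hdec N hN]

/-- Summation by parts against an eigenvector, on the modes up to `N`. -/
lemma sum_mul_linearization {M δ r : ℕ → ℝ} {c σ : ℝ} (hM0 : M 0 = 0) (hr0 : r 0 = 0)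
    (heig : ∀ n, c * M (n + 1) * (r (n + 2) + r n) = (σ + δ (n + 1)) * r (n + 1))
    (v e : ℕ → ℂ) (N : ℕ) :
    ∑ n ∈ Finset.range N, ((-1) ^ n * r (n + 1) : ℂ) *
        (-(c * (M n * v n + M (n + 2) * v (n + 2))) - δ (n + 1) * v (n + 1) - e n)
      - σ * ∑ n ∈ Finset.range N, ((-1) ^ n * r (n + 1) : ℂ) * v (n + 1)
    = c * (-1) ^ N * (M N * r (N + 1) * v N + M (N + 1) * r N * v (N + 1))
      - ∑ n ∈ Finset.range N, ((-1) ^ n * r (n + 1) : ℂ) * e n := by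
  induction N with
  | zero => simp [hM0, hr0]
  | succ N ih =>
    have h : (c * M (N + 1) * (r (N + 2) + r N) : ℂ) = (σ + δ (N + 1)) * r (N + 1) := by
      exact_mod_cast heig N
    rw [Finset.sum_range_succ, Finset.sum_range_succ, Finset.sum_range_succ]
    linear_combination ih + (-1) ^ N * v (N + 1) * h

/-- If the linearised equation has approximate solutions, with arbitrarily small error and
with a uniform bound `V`, and with data `w` on the modes `1, …, n₀`, then `V` is at least of the
size of the unstable solution at time `τ`. -/
theorem exp_mul_le_of_approx {M δ r : ℕ → ℝ} {p : ℕ → ℂ} {c σ τ w V : ℝ} {n₀ : ℕ} (hn₀ : 1 ≤ n₀)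
    (hc : 0 < c) (hσ : 0 < σ) (hτ : 0 ≤ τ) (hw : 0 ≤ w) (hV : 0 ≤ V)
    (hM0 : M 0 = 0) (hMnn : ∀ n, 0 ≤ M n)
    (hM : Tendsto M atTop (𝓝 0)) (hr0 : r 0 = 0) (hr : ∀ n, 1 ≤ n → 0 < r n)
    (heig : ∀ n, c * M (n + 1) * (r (n + 2) + r n) = (σ + δ (n + 1)) * r (n + 1))
    (hdec : ∀ n ≥ n₀, r (n + 1) ≤ r n / 2)
    (hp : ∀ n < n₀, p (n + 1) = (-1) ^ n * w) (hp' : ∀ n ≥ n₀, p (n + 1) = 0)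
    (hsol : ∀ E > 0, ∃ v e : ℕ → ℝ → ℂ,
      (∀ n, AEStronglyMeasurable (v n) (volume.restrict (Icc 0 τ))) ∧
      (∀ n, AEStronglyMeasurable (e n) (volume.restrict (Icc 0 τ))) ∧
      ∀ n, ∀ t ∈ Icc 0 τ, ‖v n t‖ ≤ V ∧ ‖e n t‖ ≤ E ∧
        v (n + 1) t = p (n + 1) + ∫ s in (0 : ℝ)..t,
          (-(c * (M n * v n s + M (n + 2) * v (n + 2) s)) - δ (n + 1) * v (n + 1) s - e n s)) :
    Real.exp (σ * τ) * w ≤ 2 * V := by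
  set ρ := ∑ n ∈ Finset.range n₀, r (n + 1) with hρ
  have hρpos : 0 < ρ := Finset.sum_pos (fun n _ => hr _ (by omega))
    ⟨0, Finset.mem_range.2 (by omega)⟩
  have main : ∀ N ≥ n₀, Real.exp (σ * τ) * w ≤ 2 * V +
      2 * (c * V * (M N + M (N + 1)) + 1 / ((N : ℝ) + 1)) * τ * Real.exp (σ * τ) := by
    intro N hN
    -- The admissible error is tied to the truncation level, so that one limit `N → ∞` removes both
    -- the error and the boundary terms of the summation by parts.
    obtain ⟨v, e, hv, he, h⟩ := hsol (1 / ((N : ℝ) + 1)) (by positivity)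
    have hrnn : ∀ n, 0 ≤ r n := fun n => by
      rcases n with _ | n
      · exact hr0.ge
      · exact (hr _ (by omega)).le
    have hsum := sum_le_of_halving hn₀ hr hdec hN
    have hsum0 : 0 ≤ ∑ n ∈ Finset.range N, r (n + 1) := Finset.sum_nonneg fun n _ => hrnn _
    have hrN : r N ≤ 2 * ρ := by linarith
    have hrN1 : r (N + 1) ≤ 2 * ρ := by linarith [hdec N hN, hrnn N]
    have hq : ∀ n, ‖((-1) ^ n * r (n + 1) : ℂ)‖ = r (n + 1) := fun n => by
      simp [abs_of_nonneg (hrnn (n + 1))]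
    have hvi : ∀ n, IntegrableOn (v n) (Icc 0 τ) := fun n =>
      Integrable.of_bound (hv n) V
        ((ae_restrict_iff' measurableSet_Icc).2 (Eventually.of_forall fun t ht => (h n t ht).1))
    have hei : ∀ n, IntegrableOn (e n) (Icc 0 τ) := fun n =>
      Integrable.of_bound (he n) _
        ((ae_restrict_iff' measurableSet_Icc).2 (Eventually.of_forall fun t ht => (h n t ht).2.1))
    set g : ℕ → ℝ → ℂ := fun n s =>
      -(c * (M n * v n s + M (n + 2) * v (n + 2) s)) - δ (n + 1) * v (n + 1) s - e n s with hg
    have hgi : ∀ n, IntegrableOn (g n) (Icc 0 τ) := fun n =>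
      (((((hvi n).const_mul _).add ((hvi (n + 2)).const_mul _)).const_mul _).neg.sub
        ((hvi (n + 1)).const_mul _)).sub (hei n)
    set y : ℝ → ℂ := fun t => ∑ n ∈ Finset.range N, ((-1) ^ n * r (n + 1) : ℂ) * v (n + 1) t
      with hy
    -- The signs of the datum match those of the test vector, so nothing cancels and only the sum
    -- `ρ` of the unknown weights enters. Thus the datum need not depend on the eigenvector.
    have hy0 : ∑ n ∈ Finset.range N, ((-1) ^ n * r (n + 1) : ℂ) * p (n + 1) = (w * ρ : ℝ) := by
      rw [← Finset.sum_subset (Finset.range_subset_range.2 hN)]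
      · rw [hρ, Finset.mul_sum]
        push_cast
        refine Finset.sum_congr rfl fun n hn => ?_
        rw [hp n (Finset.mem_range.1 hn)]
        have : ((-1 : ℂ) ^ n) * (-1) ^ n = 1 := by rw [← mul_pow]; simp
        linear_combination (w * r (n + 1) : ℂ) * this
      · intro n _ hn
        rw [hp' n (by simpa using hn), mul_zero]
    have hest := norm_sub_exp_mul_le (y := y) (y₀ := (w * ρ : ℝ)) (σ := σ) (τ := τ)
      (g := fun s => ∑ n ∈ Finset.range N, ((-1) ^ n * r (n + 1) : ℂ) * g n s)
      (ε := 2 * ρ * (c * V * (M N + M (N + 1)) + 1 / ((N : ℝ) + 1))) hσ hτ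
      (integrable_finsetSum _ fun n _ => (hgi n).const_mul _)
      (fun t ht => by
        rw [intervalIntegral.integral_finsetSum fun n _ => IntervalIntegrable.const_mul
          ((intervalIntegrable_iff_integrableOn_Icc_of_le ht.1).2
            ((hgi n).mono_set (Icc_subset_Icc_right ht.2))) _, ← hy0, ← Finset.sum_add_distrib]
        refine Finset.sum_congr rfl fun n _ => ?_
        rw [intervalIntegral.integral_const_mul, ← mul_add, (h n t ht).2.2])
      (fun s hs => by
        have hid := sum_mul_linearization hM0 hr0 heig (fun n => v n s) (fun n => e n s) N
        simp only [hg, hy]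
        rw [hid]
        have hb1 : ‖(c * (-1) ^ N * (M N * r (N + 1) * v N s + M (N + 1) * r N * v (N + 1) s) : ℂ)‖
            ≤ c * (M N * (2 * ρ) * V + M (N + 1) * (2 * ρ) * V) := by
          rw [norm_mul, norm_mul, norm_pow, norm_neg, norm_one, one_pow, mul_one,
            Complex.norm_real, Real.norm_of_nonneg hc.le]
          refine mul_le_mul_of_nonneg_left ((norm_add_le _ _).trans ?_) hc.le
          simp only [norm_mul, Complex.norm_real, Real.norm_of_nonneg (hMnn _),
            Real.norm_of_nonneg (hrnn _)]
          have h1 := hMnn N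
          have h2 := hMnn (N + 1)
          gcongr
          · exact (h N s hs).1
          · exact (h (N + 1) s hs).1
        have hb2 : ‖∑ n ∈ Finset.range N, ((-1) ^ n * r (n + 1) : ℂ) * e n s‖
            ≤ 2 * ρ * (1 / ((N : ℝ) + 1)) := by
          refine (norm_sum_le _ _).trans ?_
          calc ∑ n ∈ Finset.range N, ‖((-1) ^ n * r (n + 1) : ℂ) * e n s‖
              ≤ ∑ n ∈ Finset.range N, r (n + 1) * (1 / ((N : ℝ) + 1)) := by
                refine Finset.sum_le_sum fun n _ => ?_
                rw [norm_mul, hq]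
                exact mul_le_mul_of_nonneg_left (h n s hs).2.1 (hrnn _)
            _ = (∑ n ∈ Finset.range N, r (n + 1)) * (1 / ((N : ℝ) + 1)) := by
                rw [Finset.sum_mul]
            _ ≤ 2 * ρ * (1 / ((N : ℝ) + 1)) := by
                gcongr
                linarith [hrnn N]
        refine (norm_sub_le _ _).trans ?_
        linarith)
    have hyV : ‖y τ‖ ≤ 2 * ρ * V := by
      refine (norm_sum_le _ _).trans ?_
      calc ∑ n ∈ Finset.range N, ‖((-1) ^ n * r (n + 1) : ℂ) * v (n + 1) τ‖
          ≤ ∑ n ∈ Finset.range N, r (n + 1) * V := by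
            refine Finset.sum_le_sum fun n _ => ?_
            rw [norm_mul, hq]
            exact mul_le_mul_of_nonneg_left (h (n + 1) τ ⟨hτ, le_rfl⟩).1 (hrnn _)
        _ = (∑ n ∈ Finset.range N, r (n + 1)) * V := by rw [Finset.sum_mul]
        _ ≤ 2 * ρ * V := by
            gcongr
            linarith [hrnn N]
    have hlow : Real.exp (σ * τ) * (w * ρ) ≤ ‖y τ‖ + ‖y τ - Real.exp (σ * τ) * (w * ρ : ℝ)‖ := by
      have h1 := norm_sub_le (y τ) (y τ - Real.exp (σ * τ) * (w * ρ : ℝ))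
      have h2 : ‖(Real.exp (σ * τ) * (w * ρ : ℝ) : ℂ)‖ = Real.exp (σ * τ) * (w * ρ) := by
        rw [← Complex.ofReal_mul, Complex.norm_real, Real.norm_of_nonneg (by positivity)]
      rwa [sub_sub_cancel, h2] at h1
    refine le_of_mul_le_mul_right ?_ hρpos
    linarith
  -- The boundary terms vanish in the limit because the symbol decays in the vertical frequency.
  have hlim : Tendsto (fun N : ℕ => 2 * V +
      2 * (c * V * (M N + M (N + 1)) + 1 / ((N : ℝ) + 1)) * τ * Real.exp (σ * τ)) atTop
      (𝓝 (2 * V + 2 * (c * V * (0 + 0) + 0) * τ * Real.exp (σ * τ))) :=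
    ((((((hM.add (hM.comp (tendsto_add_atTop_nat 1))).const_mul _).add
      tendsto_one_div_add_atTop_nhds_zero_nat).const_mul _).mul_const _).mul_const _).const_add _
  have := ge_of_tendsto hlim (eventually_atTop.2 ⟨n₀, main⟩)
  simpa using this

/-! ### The steady state and the equation around it -/

/-- The frequency of `sin (m x₃)`. -/
def vertFreq (m : ℕ) : Fin 3 → ℤ := Pi.single 2 (m : ℤ)

/-- The Fourier coefficients of `a sin (m x₃)`. -/
noncomputable def sinCoeff (a : ℝ) (m : ℕ) (k : Fin 3 → ℤ) : ℂ :=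
  a / (2 * Complex.I) *
    ((if k = vertFreq m then 1 else 0) - if k = -vertFreq m then 1 else 0)

lemma vertFreq_ne_neg {m : ℕ} (hm : 1 ≤ m) : vertFreq m ≠ -vertFreq m := by
  intro h
  have := congr_fun h 2
  simp only [vertFreq, Pi.single_eq_same, Pi.neg_apply] at this
  omega

lemma mFourier_vertFreq (m : ℕ) (x : T3) : mFourier (vertFreq m) x = fourier (m : ℤ) (x 2) := by
  simp [mFourier, vertFreq, Fin.prod_univ_three]

lemma fc_sinProfile (a : ℝ) (m : ℕ) (k : Fin 3 → ℤ) :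
    fc (sinProfile a m) k = sinCoeff a m k := by
  have h : ∀ x : T3, mFourier (-k) x * (sinProfile a m x : ℂ) = a / (2 * Complex.I) *
      (mFourier (-k) x * mFourier (vertFreq m) x - mFourier (-k) x * mFourier (-vertFreq m) x) := by
    intro x
    have h1 : ((sinProfile a m x : ℝ) : ℂ) = a * ((mFourier (vertFreq m) x -
        conj (mFourier (vertFreq m) x)) / (2 * Complex.I)) := by
      rw [sinProfile, ← mFourier_vertFreq, Complex.ofReal_mul, Complex.im_eq_sub_conj]
    rw [h1, mFourier_neg (n := vertFreq m)]
    ring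
  have hint : ∀ l, Integrable (fun x : T3 => mFourier (-k) x * mFourier l x) vol := fun l =>
    (by fun_prop : Continuous fun x : T3 => mFourier (-k) x * mFourier l x).integrable_of_hasCompactSupport
      (HasCompactSupport.of_compactSpace _)
  rw [fc, integral_congr_ae (Eventually.of_forall h), integral_const_mul,
    integral_sub (hint _) (hint _), integral_mFourier_neg_mul_mFourier,
    integral_mFourier_neg_mul_mFourier, sinCoeff]

lemma sinCoeff_eq_zero {a : ℝ} {m : ℕ} {k : Fin 3 → ℤ} (h1 : k ≠ vertFreq m)
    (h2 : k ≠ -vertFreq m) : sinCoeff a m k = 0 := by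
  simp [sinCoeff, h1, h2]

/-- Every numerator vanishes where `k₁ = k₂ = 0`, so the steady state generates no velocity. -/
lemma symbolM_mul_sinCoeff (Ω β η a : ℝ) (m : ℕ) (j : Fin 3) (k : Fin 3 → ℤ) :
    (symbolM Ω β η j k : ℂ) * sinCoeff a m k = 0 := by
  by_cases h : k = vertFreq m ∨ k = -vertFreq m
  · have h0 : k 0 = 0 ∧ k 1 = 0 := by
      rcases h with h | h <;> simp [h, vertFreq]
    have : symbolM Ω β η j k = 0 := by
      unfold symbolM
      split_ifs
      · rfl
      · fin_cases j <;> simp [h0.1, h0.2]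
    rw [this, Complex.ofReal_zero, zero_mul]
  · push Not at h
    rw [sinCoeff_eq_zero h.1 h.2, mul_zero]

lemma sinCoeff_dissipation (κ γ a : ℝ) (m : ℕ) (k : Fin 3 → ℤ) :
    sinCoeff (κ * a * (m : ℝ) ^ (2 * γ)) m k =
      (κ * symbolFracLaplacian γ k : ℝ) * sinCoeff a m k := by
  by_cases h : k = vertFreq m ∨ k = -vertFreq m
  · have h0 : normSq k = (m : ℝ) ^ 2 := by
      rcases h with h | h <;> simp [h, vertFreq, normSq, Fin.sum_univ_three]
    have : symbolFracLaplacian γ k = (m : ℝ) ^ (2 * γ) := by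
      rw [symbolFracLaplacian, h0, Real.rpow_mul (by positivity), Real.rpow_two]
    rw [this]
    unfold sinCoeff
    push_cast
    ring
  · push Not at h
    rw [sinCoeff_eq_zero h.1 h.2, sinCoeff_eq_zero h.1 h.2, mul_zero]

lemma coeFn_deriv_add (u v : W14) (j : Fin 3) :
    W14.deriv (u + v) j =ᵐ[vol] fun x => W14.deriv u j x + W14.deriv v j x :=
  Lp.coeFn_add _ _

lemma fc_advection_eq (U : Fin 3 → Lp ℝ 2 vol) (w : W14) (k : Fin 3 → ℤ) :
    fc (fun x => ∑ j, U j x * W14.deriv w j x) k =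
      ∑ j, fc (fun x => U j x * W14.deriv w j x) k :=
  fc_sum _ (fun j _ => (Lp.memLp (U j)).integrable_mul (W14.memLp_deriv w j)) k

section Velocity

variable {Ω β η a : ℝ} {m : ℕ} {θ₀ w : W14} {U : Fin 3 → Lp ℝ 2 vol}

lemma IsVelocity.of_add_steady (hθ₀ : ∀ k, fc (W14.fn θ₀) k = sinCoeff a m k)
    (hU : IsVelocity Ω β η (W14.fn (θ₀ + w)) U) : IsVelocity Ω β η (W14.fn w) U where
  constitutive j k := by
    rw [hU.constitutive, W14.fc_fn_add, mul_add, hθ₀, symbolM_mul_sinCoeff, zero_add]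
  divFree := hU.divFree

/-- Advection of the steady state by the perturbation. -/
lemma fc_advection_steady (hm : 1 ≤ m) (hθ₀ : ∀ k, fc (W14.fn θ₀) k = sinCoeff a m k)
    (hU : IsVelocity Ω β η (W14.fn w) U) (k : Fin 3 → ℤ) :
    fc (fun x => ∑ j, U j x * W14.deriv θ₀ j x) k = (a * m / 2 : ℝ) *
      (symbolM Ω β η 2 (k - vertFreq m) * fc (W14.fn w) (k - vertFreq m) +
        symbolM Ω β η 2 (k + vertFreq m) * fc (W14.fn w) (k + vertFreq m)) := by
  rw [fc_advection_eq]
  have h : ∀ j, fc (fun x => U j x * W14.deriv θ₀ j x) k =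
      ∑ l ∈ {vertFreq m, -vertFreq m}, fc (U j) (k - l) * fc (W14.deriv θ₀ j) l := by
    intro j
    refine (hasSum_fc_mul (Lp.memLp (U j)) (W14.memLp_deriv θ₀ j) k).unique
      (hasSum_sum_of_ne_finset_zero fun l hl => ?_)
    simp only [Finset.mem_insert, Finset.mem_singleton, not_or] at hl
    rw [W14.fc_deriv, hθ₀, sinCoeff_eq_zero hl.1 hl.2, mul_zero, mul_zero]
  have h2 : ∀ j, fc (fun x => U j x * W14.deriv θ₀ j x) k = if j = 2 then (a * m / 2 : ℝ) *
      (fc (U 2) (k - vertFreq m) + fc (U 2) (k + vertFreq m)) else 0 := by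
    intro j
    rw [h j, Finset.sum_pair (vertFreq_ne_neg hm), W14.fc_deriv, W14.fc_deriv, hθ₀, hθ₀]
    split_ifs with hj
    · subst hj
      have hI := Complex.I_ne_zero
      simp only [sinCoeff, if_neg (vertFreq_ne_neg hm), if_neg (vertFreq_ne_neg hm).symm, if_true,
        sub_neg_eq_add, Pi.neg_apply]
      simp only [vertFreq, Pi.single_eq_same]
      push_cast
      field_simp
      ring
    · simp [vertFreq, hj]
  rw [Finset.sum_congr rfl fun j _ => h2 j, Finset.sum_ite_eq' Finset.univ, if_pos (Finset.mem_univ _),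
    hU.constitutive, hU.constitutive]

/-- As `U` comes from `w` alone, the advection splits into a part linear in `w`, which transports
the steady profile, and a quadratic part. -/
lemma fc_advection_add (hm : 1 ≤ m) (hθ₀ : ∀ k, fc (W14.fn θ₀) k = sinCoeff a m k)
    (hU : IsVelocity Ω β η (W14.fn (θ₀ + w)) U) (k : Fin 3 → ℤ) :
    fc (fun x => ∑ j, U j x * W14.deriv (θ₀ + w) j x) k = (a * m / 2 : ℝ) *
      (symbolM Ω β η 2 (k - vertFreq m) * fc (W14.fn w) (k - vertFreq m) +
        symbolM Ω β η 2 (k + vertFreq m) * fc (W14.fn w) (k + vertFreq m)) +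
      fc (fun x => ∑ j, U j x * W14.deriv w j x) k := by
  rw [← fc_advection_steady hm hθ₀ (hU.of_add_steady hθ₀) k]
  have hint : ∀ v : W14, Integrable (fun x => ∑ j, U j x * W14.deriv v j x) vol := fun v =>
    integrable_finsetSum _ fun j _ => (Lp.memLp (U j)).integrable_mul (W14.memLp_deriv v j)
  rw [← fc_add (hint θ₀) (hint w)]
  refine fc_congr_ae ?_ k
  filter_upwards [ae_all_iff.2 fun j => coeFn_deriv_add θ₀ w j] with x hx
  rw [← Finset.sum_add_distrib]
  refine Finset.sum_congr rfl fun j _ => ?_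
  rw [hx j, mul_add]

lemma norm_fc_advection_le (hΩ : 0 < Ω) (hβ : 0 < β) (hη : 0 < η)
    (hU : IsVelocity Ω β η (W14.fn w) U) (k : Fin 3 → ℤ) :
    ‖fc (fun x => ∑ j, U j x * W14.deriv w j x) k‖ ≤
      3 * (9 / (4 * Ω ^ 2) + 1) * ‖w‖ ^ 2 := by
  rw [fc_advection_eq]
  refine (norm_sum_le _ _).trans ?_
  calc ∑ j, ‖fc (fun x => U j x * W14.deriv w j x) k‖
      ≤ ∑ _j : Fin 3, (9 / (4 * Ω ^ 2) * ‖w‖ ^ 2 + ‖w‖ ^ 2) := by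
        refine Finset.sum_le_sum fun j _ => ?_
        exact (norm_fc_mul_le (Lp.memLp (U j)) (W14.memLp_deriv w j) k).trans
          (add_le_add (integral_sq_velocity_le hΩ hβ hη hU j) (W14.integral_deriv_sq_le w j))
    _ = 3 * (9 / (4 * Ω ^ 2) + 1) * ‖w‖ ^ 2 := by simp; ring

end Velocity

/-! ### From well-posedness to the linearised equation -/

lemma aestronglyMeasurable_of_hasSum {α ι : Type*} [MeasurableSpace α] [Countable ι]
    {μ : Measure α} {f : ι → α → ℂ} {g : α → ℂ} (hf : ∀ i, AEStronglyMeasurable (f i) μ)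
    (h : ∀ᵐ x ∂μ, HasSum (fun i => f i x) (g x)) : AEStronglyMeasurable g μ :=
  aestronglyMeasurable_of_tendsto_ae (atTop : Filter (Finset ι))
    (f := fun s x => ∑ i ∈ s, f i x)
    (fun s => Finset.aestronglyMeasurable_fun_sum s fun i _ => hf i) h

/-- No measurability of `U` in time is assumed. It is bypassed by writing each coefficient of the
advection as a countable convolution sum in the coefficients of `w`. -/
lemma aestronglyMeasurable_fc_advection {Ω β η τ : ℝ} {w : ℝ → W14} {U : ℝ → Fin 3 → Lp ℝ 2 vol}
    (hw : ∀ k, AEStronglyMeasurable (fun s => fc (W14.fn (w s)) k) (volume.restrict (Icc 0 τ)))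
    (hU : ∀ s ∈ Icc 0 τ, IsVelocity Ω β η (W14.fn (w s)) (U s)) (k : Fin 3 → ℤ) :
    AEStronglyMeasurable (fun s => fc (fun x => ∑ j, U s j x * W14.deriv (w s) j x) k)
      (volume.restrict (Icc 0 τ)) := by
  simp only [fc_advection_eq]
  refine Finset.aestronglyMeasurable_fun_sum _ fun j _ => ?_
  refine aestronglyMeasurable_of_hasSum
    (f := fun l s => (symbolM Ω β η j (k - l) * fc (W14.fn (w s)) (k - l)) *
      (Complex.I * (l j : ℂ) * fc (W14.fn (w s)) l))
    (fun l => ((hw _).const_mul _).mul ((hw _).const_mul _)) ?_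
  refine (ae_restrict_iff' measurableSet_Icc).2 (Eventually.of_forall fun s hs => ?_)
  have h := hasSum_fc_mul (Lp.memLp (U s j)) (W14.memLp_deriv (w s) j) k
  simpa only [(hU s hs).constitutive, W14.fc_deriv] using h

lemma fc_coe_zero_two (k : Fin 3 → ℤ) : fc (0 : Lp ℝ 2 vol) k = 0 := by
  rw [fc_congr_ae (Lp.coeFn_zero ℝ 2 vol) k]
  simp [fc]

section Nonlinear

variable {X Y : Type*} [NormedAddCommGroup X] [NormedSpace ℝ X]
  [NormedAddCommGroup Y] [NormedSpace ℝ Y]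

lemma isSolution_steady (Ω β η κ γ a : ℝ) (m : ℕ) (J : X →L[ℝ] W14) (T : ℝ) (x₀ : X)
    (hθ₀ : ∀ k, fc (W14.fn (J x₀)) k = sinCoeff a m k) :
    IsSolution Ω β η κ γ (fun _ => sinProfile (κ * a * (m : ℝ) ^ (2 * γ)) m) J T x₀
      (fun _ => x₀) where
  measurable := aestronglyMeasurable_const
  bounded := ⟨‖x₀‖, fun _ _ => le_rfl⟩
  equation := by
    refine ⟨fun _ _ => 0, fun t _ => ⟨fun j k => ?_, fun k => ?_⟩, fun t _ k => ?_⟩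
    · rw [fc_coe_zero_two, hθ₀, symbolM_mul_sinCoeff]
    · exact Finset.sum_eq_zero fun j _ => mul_eq_zero_of_right _ (fc_coe_zero_two k)
    · have h : fc (fun x => ∑ j, (0 : Lp ℝ 2 vol) x * W14.deriv (J x₀) j x) k = 0 := by
        simp [fc]
      beta_reduce
      rw [h, fc_sinProfile, hθ₀, sinCoeff_dissipation]
      simp

/-- Well-posedness yields, for every datum `f`, approximate solutions of the equation linearised
at the steady state, with a uniform bound and an arbitrarily small error. -/
theorem LocallyLipschitzWellPosed.exists_approx_linearized {Ω β η κ γ a : ℝ} {m : ℕ}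
    {J : X →L[ℝ] W14} {i : Y →L[ℝ] X} (hΩ : 0 < Ω) (hβ : 0 < β) (hη : 0 < η) (hm : 1 ≤ m)
    (hwp : LocallyLipschitzWellPosed Ω β η κ γ
      (fun _ => sinProfile (κ * a * (m : ℝ) ^ (2 * γ)) m) J i)
    (y₀ y : Y) (hθ₀ : ∀ k, fc (W14.fn (J (i y₀))) k = sinCoeff a m k) :
    ∃ τ > 0, ∃ V ≥ 0, ∀ E > 0, ∃ v e : (Fin 3 → ℤ) → ℝ → ℂ,
      (∀ k, AEStronglyMeasurable (v k) (volume.restrict (Icc 0 τ))) ∧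
      (∀ k, AEStronglyMeasurable (e k) (volume.restrict (Icc 0 τ))) ∧
      ∀ k, ∀ t ∈ Icc 0 τ, ‖v k t‖ ≤ V ∧ ‖e k t‖ ≤ E ∧
        v k t = fc (W14.fn (J (i y))) k + ∫ s in (0 : ℝ)..t,
          (-((a * m / 2 : ℝ) * (symbolM Ω β η 2 (k - vertFreq m) * v (k - vertFreq m) s +
            symbolM Ω β η 2 (k + vertFreq m) * v (k + vertFreq m) s)) -
            (κ * symbolFracLaplacian γ k : ℝ) * v k s - e k s) := by
  obtain ⟨T, K, hT, hK, hTpos, hKpos, hwp⟩ := hwp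
  set q : ℝ → ℝ≥0 × ℝ≥0 := fun ε => (‖y₀‖₊, ‖y₀ + ε • y‖₊) with hq
  have hqc : Continuous q := by fun_prop
  -- By continuity of `T` and `K`, half the lifespan and a slightly larger constant at `ε = 0` serve
  -- for all small `ε`. Hence `τ` and `V` do not depend on `E`.
  set τ := T (q 0) / 2 with hτ
  set K₁ := K (q 0) + 1 with hK₁
  have hτpos : 0 < τ := half_pos (hTpos _)
  have hK₁pos : 0 < K₁ := by linarith [hKpos (q 0)]
  set V := ‖J‖ * (K₁ * ‖y‖) with hV
  have hVnn : 0 ≤ V := by positivity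
  set C := 3 * (9 / (4 * Ω ^ 2) + 1) with hC
  have hCpos : 0 < C := by positivity
  refine ⟨τ, hτpos, V, hVnn, fun E hE => ?_⟩
  have hev : ∀ᶠ ε in 𝓝 (0 : ℝ), τ < T (q ε) ∧ K (q ε) < K₁ ∧ ε * (C * V ^ 2) < E := by
    refine Filter.Eventually.and ?_ (Filter.Eventually.and ?_ ?_)
    · exact (hT.comp hqc).continuousAt.eventually (lt_mem_nhds (half_lt_self (hTpos _)))
    · exact (hK.comp hqc).continuousAt.eventually (gt_mem_nhds (lt_add_one _))
    · exact (by fun_prop : Continuous fun ε : ℝ => ε * (C * V ^ 2)).continuousAt.eventually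
        (gt_mem_nhds (by simpa using hE))
  obtain ⟨ε, ⟨hε1, hε2, hε3⟩, hε⟩ := ((hev.filter_mono nhdsWithin_le_nhds).and
    (self_mem_nhdsWithin : Ioi (0 : ℝ) ∈ 𝓝[>] 0)).exists
  have hεpos : 0 < ε := hε
  have hεne : (ε : ℂ) ≠ 0 := by exact_mod_cast hεpos.ne'
  obtain ⟨Θ₁, Θ₂, hΘ₁, hΘ₂, hlip⟩ := hwp y₀ (y₀ + ε • y)
  have hsub : Icc 0 τ ⊆ Icc 0 (T (q ε)) := Icc_subset_Icc_right hε1.le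
  -- Uniqueness identifies the first solution with the steady state.
  have hconst : ∀ t ∈ Icc 0 τ, Θ₁ t = i y₀ := fun t ht =>
    (hΘ₁.2 _ (isSolution_steady Ω β η κ γ a m J _ (i y₀) hθ₀) t (hsub ht)).symm
  set Q : ℝ → W14 := fun s => J (Θ₂ s) - J (i y₀) with hQ
  have hQadd : ∀ s, J (Θ₂ s) = J (i y₀) + Q s := fun s => by simp [hQ]
  have hQnorm : ∀ s ∈ Icc 0 τ, ‖Q s‖ ≤ ε * V := by
    intro s hs
    have h1 := hlip s (hsub hs)
    rw [hconst s hs, sub_add_cancel_left, norm_neg, norm_smul, Real.norm_of_nonneg hεpos.le] at h1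
    calc ‖Q s‖ = ‖J (Θ₂ s - i y₀)‖ := by rw [map_sub]
      _ ≤ ‖J‖ * ‖Θ₂ s - i y₀‖ := J.le_opNorm _
      _ ≤ ‖J‖ * (K₁ * (ε * ‖y‖)) := by
        rw [norm_sub_rev]
        gcongr
        exact h1.trans (by gcongr)
      _ = ε * V := by rw [hV]; ring
  obtain ⟨U, hU, heq⟩ := hΘ₂.1.equation
  have hUadd : ∀ s ∈ Icc 0 τ, IsVelocity Ω β η (W14.fn (J (i y₀) + Q s)) (U s) := fun s hs => by
    rw [← hQadd]; exact hU s (hsub hs)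
  have hUQ : ∀ s ∈ Icc 0 τ, IsVelocity Ω β η (W14.fn (Q s)) (U s) := fun s hs =>
    (hUadd s hs).of_add_steady hθ₀
  have hQmeas : ∀ k, AEStronglyMeasurable (fun s => fc (W14.fn (Q s)) k)
      (volume.restrict (Icc 0 τ)) := by
    intro k
    have h1 : AEStronglyMeasurable Θ₂ (volume.restrict (Icc 0 τ)) :=
      hΘ₂.1.measurable.mono_measure (Measure.restrict_mono hsub le_rfl)
    have h2 : Continuous fun x : X => fcL k (J x - J (i y₀)) := by fun_prop
    exact h2.comp_aestronglyMeasurable h1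
  have hnorm : ‖(ε : ℂ)⁻¹‖ = ε⁻¹ := by
    rw [norm_inv, Complex.norm_real, Real.norm_of_nonneg hεpos.le]
  refine ⟨fun k s => (ε : ℂ)⁻¹ * fc (W14.fn (Q s)) k,
    fun k s => (ε : ℂ)⁻¹ * fc (fun x => ∑ j, U s j x * W14.deriv (Q s) j x) k,
    fun k => (hQmeas k).const_mul _,
    fun k => (aestronglyMeasurable_fc_advection hQmeas hUQ k).const_mul _,
    fun k t ht => ⟨?_, ?_, ?_⟩⟩
  · rw [norm_mul, hnorm, inv_mul_le_iff₀ hεpos]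
    exact (W14.norm_fc_fn_le _ _).trans (hQnorm t ht)
  · rw [norm_mul, hnorm, inv_mul_le_iff₀ hεpos]
    -- The quadratic term is of order `ε²`, so an order `ε` remains after division by `ε`.
    calc _ ≤ C * ‖Q t‖ ^ 2 := norm_fc_advection_le hΩ hβ hη (hUQ t ht) k
      _ ≤ C * (ε * V) ^ 2 := by gcongr; exact hQnorm t ht
      _ = ε * (ε * (C * V ^ 2)) := by ring
      _ ≤ ε * E := by gcongr
  · have h1 := heq t (hsub ht) k
    rw [hQadd, W14.fc_fn_add, map_add, map_smul, map_add, map_smul, W14.fc_fn_add,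
      W14.fc_fn_smul, add_assoc] at h1
    have h2 := add_left_cancel h1
    beta_reduce
    rw [h2, mul_add, inv_mul_cancel_left₀ hεne, ← intervalIntegral.integral_const_mul]
    congr 1
    refine intervalIntegral.integral_congr fun s hs => ?_
    rw [uIcc_of_le ht.1] at hs
    have hs' : s ∈ Icc 0 τ := ⟨hs.1, hs.2.trans ht.2⟩
    rw [hQadd, fc_advection_add hm hθ₀ (hUadd s hs'), W14.fc_fn_add, fc_sinProfile,
      sinCoeff_dissipation, hθ₀]
    ring

end Nonlinear

/-! ### Data with prescribed Fourier coefficients -/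

/-- An absolutely convergent Hermitian Fourier series is a continuous real function. -/
theorem exists_continuousMap_fc {c : (Fin 3 → ℤ) → ℂ} (hc : Summable fun k => ‖c k‖)
    (hconj : ∀ k, c (-k) = conj (c k)) : ∃ f : C(T3, ℝ), ∀ k, fc f k = c k := by
  have hle : ∀ k (x : T3), ‖c k * mFourier k x‖ ≤ ‖c k‖ := fun k x => by
    rw [norm_mul]
    exact mul_le_of_le_one_right (norm_nonneg _)
      (((mFourier k).norm_coe_le_norm x).trans mFourier_norm.le)
  set F : T3 → ℂ := fun x => ∑' k, c k * mFourier k x with hF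
  have hFc : Continuous F := continuous_tsum (fun k => by fun_prop) hc hle
  have hreal : ∀ x, ((F x).re : ℂ) = F x := by
    intro x
    rw [← Complex.conj_eq_iff_re, hF]
    beta_reduce
    rw [Complex.conj_tsum, ← (Equiv.neg (Fin 3 → ℤ)).tsum_eq fun k => c k * mFourier k x]
    refine tsum_congr fun k => ?_
    rw [Equiv.neg_apply, hconj, mFourier_neg, map_mul]
  refine ⟨⟨fun x => (F x).re, Complex.continuous_re.comp hFc⟩, fun k => ?_⟩
  have hint : ∀ l, Integrable (fun x : T3 => mFourier (-k) x * (c l * mFourier l x)) vol := fun l =>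
    (by fun_prop : Continuous fun x : T3 => mFourier (-k) x * (c l * mFourier l x)).integrable_of_hasCompactSupport
      (HasCompactSupport.of_compactSpace _)
  have hbd : ∀ l, ∫ x, ‖mFourier (-k) x * (c l * mFourier l x)‖ ∂vol ≤ ‖c l‖ := by
    intro l
    have h1 : ∀ x : T3, ‖mFourier (-k) x * (c l * mFourier l x)‖ ≤ ‖c l‖ := fun x => by
      rw [norm_mul]
      exact (mul_le_of_le_one_left (norm_nonneg _)
        (((mFourier (-k)).norm_coe_le_norm x).trans mFourier_norm.le)).trans (hle l x)
    refine (integral_mono (hint l).norm (integrable_const _) h1).trans ?_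
    simp
  have h := hasSum_integral_of_summable_integral_norm hint
    (hc.of_nonneg_of_le (fun l => integral_nonneg fun x => norm_nonneg _) hbd)
  have h1 : fc (fun x => (F x).re) k = ∫ x, ∑' l, mFourier (-k) x * (c l * mFourier l x) ∂vol := by
    refine integral_congr_ae (Eventually.of_forall fun x => ?_)
    simp only [hreal]
    rw [hF, tsum_mul_left]
  refine h1.trans (h.unique ?_)
  refine (hasSum_ite_eq k (c k)).congr_fun fun l => ?_
  simp_rw [mul_left_comm _ (c l)]
  rw [integral_const_mul, integral_mFourier_neg_mul_mFourier]
  split_ifs with h2 h3 h3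
  · rw [h2, mul_one]
  · exact absurd h2.symm h3
  · exact absurd h3.symm h2
  · rw [mul_zero]

theorem exists_W14_fc {c : (Fin 3 → ℤ) → ℂ} (hc : Summable fun k => ‖c k‖)
    (hc' : ∀ j, Summable fun k : Fin 3 → ℤ => ‖(k j : ℂ) * c k‖)
    (hconj : ∀ k, c (-k) = conj (c k)) : ∃ f : W14, ∀ k, fc (W14.fn f) k = c k := by
  obtain ⟨f, hf⟩ := exists_continuousMap_fc hc hconj
  have hg : ∀ j, ∃ g : C(T3, ℝ), ∀ k, fc g k = Complex.I * (k j : ℂ) * c k := by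
    intro j
    refine exists_continuousMap_fc ?_ fun k => ?_
    · refine (hc' j).congr fun k => ?_
      rw [mul_assoc, norm_mul Complex.I, Complex.norm_I, one_mul]
    · rw [hconj, map_mul, map_mul, Complex.conj_I, Pi.neg_apply, map_intCast]
      push_cast
      ring
  choose g hg using hg
  have hfc : ∀ (u : C(T3, ℝ)) k, fc (ContinuousMap.toLp (E := ℝ) 4 vol ℝ u) k = fc u k := fun u k =>
    fc_congr_ae (ContinuousMap.coeFn_toLp vol u) k
  refine ⟨⟨(ContinuousMap.toLp (E := ℝ) 4 vol ℝ f, fun j => ContinuousMap.toLp (E := ℝ) 4 vol ℝ (g j)),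
    fun j k => ?_⟩, fun k => ?_⟩
  · simp only [hfc, hg, hf]
  · exact (hfc f k).trans (hf k)

lemma finite_support_sinCoeff (a : ℝ) (m : ℕ) : (Function.support (sinCoeff a m)).Finite := by
  refine (Set.toFinite {vertFreq m, -vertFreq m}).subset fun k hk => ?_
  by_contra h
  simp only [mem_insert_iff, mem_singleton_iff, not_or] at h
  exact hk (sinCoeff_eq_zero h.1 h.2)

/-- The steady state `a sin (m x₃)` as an admissible datum. -/
theorem exists_steady (a : ℝ) {m : ℕ} (hm : 1 ≤ m) : ∃ f : W14,
    IsSmooth (W14.fn f) ∧ HasZeroVerticalMean (W14.fn f) ∧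
      ∀ k, fc (W14.fn f) k = sinCoeff a m k := by
  have hsum : ∀ g : (Fin 3 → ℤ) → ℂ, Summable fun k => ‖g k * sinCoeff a m k‖ := fun g =>
    summable_of_hasFiniteSupport ((finite_support_sinCoeff a m).subset fun k hk h => hk (by simp [h]))
  obtain ⟨f, hf⟩ := exists_W14_fc (c := sinCoeff a m) (by simpa using hsum 1) (fun j => hsum _)
    (fun k => by
      simp only [sinCoeff, map_mul, map_sub, map_div₀, Complex.conj_ofReal, Complex.conj_I,
        neg_eq_iff_eq_neg, neg_neg, apply_ite conj, map_one, map_zero, map_ofNat, mul_neg, div_neg]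
      ring)
  refine ⟨f, fun N => ?_, fun k hk => ?_, hf⟩
  · obtain ⟨C, hC⟩ := (((finite_support_sinCoeff a m).image
      fun k => (1 + ∑ j, (k j : ℝ) ^ 2) ^ N * ‖sinCoeff a m k‖)).bddAbove
    refine ⟨max C 0, fun k => ?_⟩
    rw [hf]
    by_cases hk : sinCoeff a m k = 0
    · rw [hk, norm_zero, mul_zero]
      exact le_max_right _ _
    · exact (hC (mem_image_of_mem _ hk)).trans (le_max_left _ _)
  · rw [hf]
    refine sinCoeff_eq_zero ?_ ?_ <;> rintro rfl <;> simp [vertFreq] at hk <;> omega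

/-- The frequencies `((j+1)², j+1, n m)`. -/
def mode (m j n : ℕ) : Fin 3 → ℤ := ![((j : ℤ) + 1) ^ 2, (j : ℤ) + 1, (n : ℤ) * m]

lemma mode_succ_sub (m j n : ℕ) : mode m j (n + 1) - vertFreq m = mode m j n := by
  funext i
  fin_cases i <;> simp [mode, vertFreq]
  ring

lemma mode_succ_add (m j n : ℕ) : mode m j (n + 1) + vertFreq m = mode m j (n + 2) := by
  funext i
  fin_cases i <;> simp [mode, vertFreq]
  ring

lemma mode_injective {m : ℕ} (hm : 1 ≤ m) :
    Function.Injective fun p : ℕ × ℕ => mode m p.1 (p.2 + 1) := by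
  rintro ⟨j, n⟩ ⟨j', n'⟩ h
  have h1 := congr_fun h 1
  have h2 := congr_fun h 2
  simp only [mode, Matrix.cons_val_one, Matrix.cons_val_zero, Matrix.cons_val] at h1 h2
  have h3 : ((n + 1 : ℕ) : ℤ) = (n' + 1 : ℕ) :=
    mul_right_cancel₀ (by exact_mod_cast (by omega : m ≠ 0)) h2
  ext <;> simp only <;> omega

/-- Half of the coefficients of the datum: `(-1)ⁿ exp (-(j+1))` at the modes `n + 1`, `n < n₀`. -/
noncomputable def datumCoeff (m n₀ : ℕ) : (Fin 3 → ℤ) → ℝ :=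
  Function.extend (fun p : ℕ × ℕ => mode m p.1 (p.2 + 1))
    (fun p => if p.2 < n₀ then (-1) ^ p.2 * Real.exp (-((p.1 : ℝ) + 1)) else 0) 0

lemma datumCoeff_mode {m : ℕ} (hm : 1 ≤ m) (n₀ j n : ℕ) : datumCoeff m n₀ (mode m j (n + 1)) =
    if n < n₀ then (-1) ^ n * Real.exp (-((j : ℝ) + 1)) else 0 :=
  (mode_injective hm).extend_apply _ _ (j, n)

lemma datumCoeff_eq_zero {m : ℕ} (n₀ : ℕ) {k : Fin 3 → ℤ}
    (hk : k ∉ range fun p : ℕ × ℕ => mode m p.1 (p.2 + 1)) : datumCoeff m n₀ k = 0 :=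
  Function.extend_apply' _ _ _ hk

lemma datumCoeff_eq_zero_of_nonpos {m : ℕ} (hm : 1 ≤ m) (n₀ : ℕ) {k : Fin 3 → ℤ} (hk : k 2 ≤ 0) :
    datumCoeff m n₀ k = 0 := by
  refine datumCoeff_eq_zero n₀ ?_
  rintro ⟨p, rfl⟩
  simp only [mode, Matrix.cons_val] at hk
  have : (0 : ℤ) < ((p.2 + 1 : ℕ) : ℤ) * m := by positivity
  omega

/-- With `x = j + 1` the weight is at most a constant times `x ^ (4 * N)`, which `exp (-x)`
dominates with a further `x²` to spare; this leaves a bound summable in `j`. -/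
lemma datumCoeff_decay {m : ℕ} (hm : 1 ≤ m) (n₀ N : ℕ) : ∃ C, 0 ≤ C ∧ ∀ j n,
    (1 + normSq (mode m j (n + 1))) ^ N * |datumCoeff m n₀ (mode m j (n + 1))| ≤
      C * ((1 / ((j : ℝ) + 1) ^ 2) * if n < n₀ then 1 else 0) := by
  set B : ℝ := 3 + ((n₀ : ℝ) * m) ^ 2 with hB
  refine ⟨B ^ N * (4 * N + 2).factorial, by positivity, fun j n => ?_⟩
  rw [datumCoeff_mode hm]
  split_ifs with hn
  · set x : ℝ := (j : ℝ) + 1 with hx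
    have hx1 : 1 ≤ x := by simp [hx]
    have hx2 : x ^ 2 ≤ x ^ 4 := pow_le_pow_right₀ hx1 (by norm_num)
    have hx4 : 1 ≤ x ^ 4 := one_le_pow₀ hx1
    have hn' : ((n : ℝ) + 1) * m ≤ n₀ * m := by
      gcongr
      exact_mod_cast hn
    have hnorm : 1 + normSq (mode m j (n + 1)) ≤ B * x ^ 4 := by
      have : normSq (mode m j (n + 1)) = x ^ 4 + x ^ 2 + (((n : ℝ) + 1) * m) ^ 2 := by
        simp [normSq, mode, Fin.sum_univ_three, hx]
        ring
      rw [this, hB]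
      have h1 : (((n : ℝ) + 1) * m) ^ 2 ≤ ((n₀ : ℝ) * m) ^ 2 := by gcongr
      nlinarith [mul_le_mul_of_nonneg_left hx4 (sq_nonneg ((n₀ : ℝ) * m))]
    have hexp : x ^ (4 * N + 2) * Real.exp (-x) ≤ (4 * N + 2).factorial := by
      have h := Real.pow_div_factorial_le_exp x (by positivity) (4 * N + 2)
      rw [div_le_iff₀ (by positivity)] at h
      rw [Real.exp_neg, ← div_eq_mul_inv, div_le_iff₀ (Real.exp_pos _)]
      linarith
    have hnn : 0 ≤ normSq (mode m j (n + 1)) := Finset.sum_nonneg fun _ _ => sq_nonneg _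
    rw [abs_mul, abs_pow, abs_neg, abs_one, one_pow, one_mul, Real.abs_exp, mul_one, mul_one_div,
      le_div_iff₀ (by positivity)]
    calc (1 + normSq (mode m j (n + 1))) ^ N * Real.exp (-x) * x ^ 2
        ≤ (B * x ^ 4) ^ N * Real.exp (-x) * x ^ 2 := by gcongr
      _ = B ^ N * (x ^ (4 * N + 2) * Real.exp (-x)) := by
        rw [mul_pow, ← pow_mul, pow_add]; ring
      _ ≤ _ := by gcongr
  · simp

lemma datumCoeff_decay' {m : ℕ} (hm : 1 ≤ m) (n₀ N : ℕ) : ∃ C, 0 ≤ C ∧ ∀ k,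
    (1 + normSq k) ^ N * |datumCoeff m n₀ k| ≤ C := by
  obtain ⟨C, hC0, hC⟩ := datumCoeff_decay hm n₀ N
  refine ⟨C, hC0, fun k => ?_⟩
  by_cases hk : k ∈ range fun p : ℕ × ℕ => mode m p.1 (p.2 + 1)
  · obtain ⟨p, rfl⟩ := hk
    refine (hC p.1 p.2).trans (mul_le_of_le_one_right hC0 ?_)
    have : (1 : ℝ) ≤ ((p.1 : ℝ) + 1) ^ 2 := one_le_pow₀ (by simp)
    refine mul_le_one₀ ((div_le_one (by positivity)).2 this) ?_ ?_ <;> split_ifs <;> norm_num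
  · rw [datumCoeff_eq_zero n₀ hk, abs_zero, mul_zero]
    exact hC0

lemma summable_datumCoeff {m : ℕ} (hm : 1 ≤ m) (n₀ : ℕ) :
    Summable fun k => (1 + normSq k) * |datumCoeff m n₀ k| := by
  obtain ⟨C, hC0, hC⟩ := datumCoeff_decay hm n₀ 1
  rw [← (mode_injective hm).summable_iff fun k hk => by rw [datumCoeff_eq_zero n₀ hk]; simp]
  have h1 : Summable fun j : ℕ => 1 / ((j : ℝ) + 1) ^ 2 := by
    have := (summable_nat_add_iff 1).2 (Real.summable_one_div_nat_pow.2 one_lt_two)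
    simpa using this
  have h2 : Summable fun n : ℕ => (if n < n₀ then (1 : ℝ) else 0) :=
    summable_of_hasFiniteSupport ((Set.finite_Iio n₀).subset fun n hn => by
      by_contra h
      exact hn (if_neg (by simpa using h)))
  refine ((h1.mul_of_nonneg h2 (fun j => by positivity)
    (fun n => by dsimp only; split_ifs <;> norm_num)).mul_left C).of_nonneg_of_le
    (fun p => ?_) (fun p => ?_)
  · have hnn : 0 ≤ normSq (mode m p.1 (p.2 + 1)) := Finset.sum_nonneg fun _ _ => sq_nonneg _
    simp only [Function.comp_apply]
    positivity
  · simpa using hC p.1 p.2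

lemma normSq_neg (k : Fin 3 → ℤ) : normSq (-k) = normSq k := by simp [normSq]

lemma normSq_nonneg (k : Fin 3 → ℤ) : 0 ≤ normSq k := Finset.sum_nonneg fun _ _ => sq_nonneg _

lemma abs_le_one_add_normSq (k : Fin 3 → ℤ) (j : Fin 3) : |(k j : ℝ)| ≤ 1 + normSq k := by
  have h1 : (k j : ℝ) ^ 2 ≤ normSq k :=
    Finset.single_le_sum (f := fun i => (k i : ℝ) ^ 2) (fun _ _ => sq_nonneg _) (Finset.mem_univ j)
  nlinarith [sq_abs (k j : ℝ), sq_nonneg (|(k j : ℝ)| - 1)]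

/-- A smooth datum that excites the modes `1, …, n₀` of all the sectors `((j+1)², j+1)`. -/
theorem exists_datum {m : ℕ} (hm : 1 ≤ m) (n₀ : ℕ) : ∃ f : W14,
    IsSmooth (W14.fn f) ∧ HasZeroVerticalMean (W14.fn f) ∧
      ∀ j n, fc (W14.fn f) (mode m j (n + 1)) =
        if n < n₀ then (-1) ^ n * ((Real.exp (-((j : ℝ) + 1)) : ℝ) : ℂ) else 0 := by
  -- The reflection makes the function real. It does not disturb the prescribed coefficients, since
  -- `datumCoeff` lives on `k₃ > 0`.
  set c : (Fin 3 → ℤ) → ℂ := fun k => ((datumCoeff m n₀ k + datumCoeff m n₀ (-k) : ℝ) : ℂ) with hc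
  have hcle : ∀ k, ‖c k‖ ≤ |datumCoeff m n₀ k| + |datumCoeff m n₀ (-k)| := fun k => by
    rw [hc, Complex.norm_real]
    exact abs_add_le _ _
  have hsum : Summable fun k => (1 + normSq k) * ‖c k‖ := by
    have h1 := summable_datumCoeff hm n₀
    have h2 := (Equiv.neg (Fin 3 → ℤ)).summable_iff.2 h1
    refine (h1.add h2).of_nonneg_of_le (fun k => ?_) (fun k => ?_)
    · have := normSq_nonneg k
      positivity
    · simp only [Function.comp_apply, Equiv.neg_apply, normSq_neg, ← mul_add]
      have := normSq_nonneg k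
      gcongr
      exact hcle k
  obtain ⟨f, hf⟩ := exists_W14_fc (c := c)
    (hsum.of_nonneg_of_le (fun k => norm_nonneg _) fun k =>
      le_mul_of_one_le_left (norm_nonneg _) (by linarith [normSq_nonneg k]))
    (fun j => hsum.of_nonneg_of_le (fun k => norm_nonneg _) fun k => by
      rw [norm_mul, Complex.norm_intCast]
      gcongr
      exact abs_le_one_add_normSq k j)
    (fun k => by simp only [hc, neg_neg, Complex.conj_ofReal]; rw [add_comm])
  refine ⟨f, fun N => ?_, fun k hk => ?_, fun j n => ?_⟩
  · obtain ⟨C, hC0, hC⟩ := datumCoeff_decay' hm n₀ N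
    refine ⟨C + C, fun k => ?_⟩
    rw [hf]
    have h1 := hC k
    have h2 := hC (-k)
    rw [normSq_neg] at h2
    have := normSq_nonneg k
    calc (1 + normSq k) ^ N * ‖c k‖
        ≤ (1 + normSq k) ^ N * (|datumCoeff m n₀ k| + |datumCoeff m n₀ (-k)|) := by
          gcongr; exact hcle k
      _ ≤ C + C := by linarith
  · rw [hf, hc]
    simp only
    rw [datumCoeff_eq_zero_of_nonpos hm n₀ hk.le,
      datumCoeff_eq_zero_of_nonpos hm n₀ (k := -k) (by simp [hk])]
    simp
  · rw [hf, hc]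
    simp only
    rw [datumCoeff_mode hm, datumCoeff_eq_zero_of_nonpos hm n₀ (k := -mode m j (n + 1))
      (by simp only [Pi.neg_apply, mode, Matrix.cons_val]; exact neg_nonpos.2 (by positivity)), add_zero]
    split_ifs <;> push_cast <;> rfl

/-! ### Growth against dissipation along the parabola -/

lemma normSq_mode (m j n : ℕ) :
    normSq (mode m j n) = ((j : ℝ) + 1) ^ 4 + ((j : ℝ) + 1) ^ 2 + ((n : ℝ) * m) ^ 2 := by
  simp [normSq, mode, Fin.sum_univ_three]
  ring

lemma symbolM_mode_zero (Ω β η : ℝ) (m j : ℕ) : symbolM Ω β η 2 (mode m j 0) = 0 := by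
  simp [symbolM, mode]

lemma symbolM_mode {m n : ℕ} (hm : 1 ≤ m) (hn : 1 ≤ n) (Ω β η : ℝ) (j : ℕ) :
    symbolM Ω β η 2 (mode m j n) =
      β ^ 2 / η * ((j : ℝ) + 1) ^ 2 * (((j : ℝ) + 1) ^ 4 + ((j : ℝ) + 1) ^ 2) /
        (4 * Ω ^ 2 * ((n : ℝ) * m) ^ 2 *
          (((j : ℝ) + 1) ^ 4 + ((j : ℝ) + 1) ^ 2 + ((n : ℝ) * m) ^ 2) +
        (β ^ 2 / η) ^ 2 * ((j : ℝ) + 1) ^ 4) := by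
  have h : mode m j n 2 ≠ 0 := by
    simp only [mode, Matrix.cons_val]
    positivity
  rw [symbolM, if_neg h, symbolDenom, normSq_mode]
  simp [mode]
  ring

section Asymptotics

variable {Ω β η : ℝ} {m : ℕ}

lemma symbolM_mode_nonneg (hη : 0 < η) (hm : 1 ≤ m) (j n : ℕ) :
    0 ≤ symbolM Ω β η 2 (mode m j n) := by
  rcases Nat.eq_zero_or_pos n with rfl | hn
  · exact (symbolM_mode_zero Ω β η m j).ge
  · rw [symbolM_mode hm hn]
    positivity

lemma symbolM_mode_le (hΩ : 0 < Ω) (hη : 0 < η) (hm : 1 ≤ m) {n : ℕ} (hn : 1 ≤ n) (j : ℕ) :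
    symbolM Ω β η 2 (mode m j n) ≤
      β ^ 2 / η * ((j : ℝ) + 1) ^ 2 / (4 * Ω ^ 2 * (m : ℝ) ^ 2) * (1 / (n : ℝ) ^ 2) := by
  have hm' : (0 : ℝ) < m := by exact_mod_cast hm
  have hn' : (0 : ℝ) < n := by exact_mod_cast hn
  rw [symbolM_mode hm hn]
  set x : ℝ := (j : ℝ) + 1
  have hx : 0 < x := by positivity
  rw [div_mul_div_comm, mul_one]
  calc β ^ 2 / η * x ^ 2 * (x ^ 4 + x ^ 2) /
        (4 * Ω ^ 2 * ((n : ℝ) * m) ^ 2 * (x ^ 4 + x ^ 2 + ((n : ℝ) * m) ^ 2) +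
          (β ^ 2 / η) ^ 2 * x ^ 4)
      ≤ β ^ 2 / η * x ^ 2 * (x ^ 4 + x ^ 2) /
        (4 * Ω ^ 2 * ((n : ℝ) * m) ^ 2 * (x ^ 4 + x ^ 2)) := by
        gcongr
        have h1 : 0 ≤ 4 * Ω ^ 2 * ((n : ℝ) * m) ^ 2 * ((n : ℝ) * m) ^ 2 := by positivity
        have h2 : 0 ≤ (β ^ 2 / η) ^ 2 * x ^ 4 := by positivity
        linarith
    _ = β ^ 2 / η * x ^ 2 / (4 * Ω ^ 2 * (m : ℝ) ^ 2 * (n : ℝ) ^ 2) := by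
        field_simp

lemma tendsto_symbolM_mode (hΩ : 0 < Ω) (hη : 0 < η) (hm : 1 ≤ m) (j : ℕ) :
    Tendsto (fun n => symbolM Ω β η 2 (mode m j n)) atTop (𝓝 0) := by
  have h : Tendsto (fun n : ℕ => β ^ 2 / η * ((j : ℝ) + 1) ^ 2 / (4 * Ω ^ 2 * (m : ℝ) ^ 2) *
      (1 / (n : ℝ) ^ 2)) atTop (𝓝 0) := by
    have h1 : Tendsto (fun n : ℕ => 1 / (n : ℝ) ^ 2) atTop (𝓝 0) := by
      have := tendsto_inv_atTop_zero.comp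
        ((tendsto_pow_atTop (α := ℝ) two_ne_zero).comp tendsto_natCast_atTop_atTop)
      simpa [Function.comp_def] using this
    simpa using h1.const_mul (β ^ 2 / η * ((j : ℝ) + 1) ^ 2 / (4 * Ω ^ 2 * (m : ℝ) ^ 2))
  refine squeeze_zero' (Eventually.of_forall (symbolM_mode_nonneg hη hm j)) ?_ h
  filter_upwards [eventually_ge_atTop 1] with n hn
  exact symbolM_mode_le hΩ hη hm hn j

/-- The lower bound of the symbol on the modes `1` and `2`. -/
lemma le_symbolM_mode (hΩ : 0 < Ω) (hβ : 0 < β) (hη : 0 < η) (hm : 1 ≤ m) {n : ℕ} (hn : 1 ≤ n)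
    (hn2 : n ≤ 2) (j : ℕ) :
    β ^ 2 / η * ((j : ℝ) + 1) ^ 2 /
        (16 * Ω ^ 2 * (m : ℝ) ^ 2 * (1 + 4 * (m : ℝ) ^ 2) + (β ^ 2 / η) ^ 2) ≤
      symbolM Ω β η 2 (mode m j n) := by
  have hm' : (0 : ℝ) < m := by exact_mod_cast hm
  have hn' : (0 : ℝ) < n := by exact_mod_cast hn
  rw [symbolM_mode hm hn]
  set x : ℝ := (j : ℝ) + 1 with hx
  have hx1 : 1 ≤ x := by simp [hx]
  -- With `n ≤ 2`, this lets the whole denominator be bounded by a constant times `x⁴ + x²`, which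
  -- cancels against the numerator.
  have hK : 1 ≤ x ^ 4 + x ^ 2 := by
    have h1 : 1 ≤ x ^ 4 := one_le_pow₀ hx1
    have h2 : 0 ≤ x ^ 2 := sq_nonneg x
    linarith
  have hnm : ((n : ℝ) * m) ^ 2 ≤ 4 * (m : ℝ) ^ 2 := by
    rw [mul_pow]
    gcongr
    have : (n : ℝ) ≤ 2 := by exact_mod_cast hn2
    nlinarith
  rw [div_le_div_iff₀ (by positivity) (by positivity), mul_assoc (_ * x ^ 2)]
  gcongr
  calc 4 * Ω ^ 2 * ((n : ℝ) * m) ^ 2 * (x ^ 4 + x ^ 2 + ((n : ℝ) * m) ^ 2) +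
        (β ^ 2 / η) ^ 2 * x ^ 4
      ≤ 4 * Ω ^ 2 * (4 * (m : ℝ) ^ 2) * (x ^ 4 + x ^ 2 + 4 * (m : ℝ) ^ 2) +
        (β ^ 2 / η) ^ 2 * (x ^ 4 + x ^ 2) := by
        gcongr
        exact le_add_of_nonneg_right (sq_nonneg x)
    _ ≤ 4 * Ω ^ 2 * (4 * (m : ℝ) ^ 2) * (x ^ 4 + x ^ 2 + 4 * (m : ℝ) ^ 2 * (x ^ 4 + x ^ 2)) +
        (β ^ 2 / η) ^ 2 * (x ^ 4 + x ^ 2) := by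
        have h4 : 4 * (m : ℝ) ^ 2 ≤ 4 * (m : ℝ) ^ 2 * (x ^ 4 + x ^ 2) :=
          le_mul_of_one_le_right (by positivity) hK
        gcongr
    _ = _ := by ring

/-- The dissipation is of lower order than the growth rate. -/
lemma eventually_dissipation_le {κ γ B : ℝ} (hκ : 0 < κ) (hγ : γ ∈ Ioo (0 : ℝ) (1 / 2))
    (hB : 0 < B) (m : ℕ) :
    ∀ᶠ j : ℕ in atTop, ∀ n ≤ 2,
      κ * symbolFracLaplacian γ (mode m j n) ≤ B * ((j : ℝ) + 1) ^ 2 := by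
  set A : ℝ := 2 + 4 * (m : ℝ) ^ 2 with hA
  have hApos : 0 < A := by positivity
  have hx : Tendsto (fun j : ℕ => (j : ℝ) + 1) atTop atTop :=
    tendsto_atTop_add_const_right _ _ tendsto_natCast_atTop_atTop
  have h := (((tendsto_rpow_neg_atTop (show 0 < 2 - 4 * γ by linarith [hγ.2])).comp hx).const_mul
    (κ * A ^ γ))
  rw [mul_zero] at h
  filter_upwards [h.eventually (gt_mem_nhds hB)] with j hj n hn
  simp only [Function.comp_apply] at hj
  set x : ℝ := (j : ℝ) + 1 with hxdef
  have hx1 : 1 ≤ x := by simp [hxdef]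
  have hx0 : 0 < x := by linarith
  have hnorm : normSq (mode m j n) ≤ A * x ^ 4 := by
    rw [normSq_mode, ← hxdef, hA]
    have h1 : x ^ 2 ≤ x ^ 4 := pow_le_pow_right₀ hx1 (by norm_num)
    have h2 : 1 ≤ x ^ 4 := one_le_pow₀ hx1
    have h3 : ((n : ℝ) * m) ^ 2 ≤ 4 * (m : ℝ) ^ 2 := by
      rw [mul_pow]
      gcongr
      have : (n : ℝ) ≤ 2 := by exact_mod_cast hn
      nlinarith [(Nat.cast_nonneg n : (0 : ℝ) ≤ n)]
    nlinarith [mul_le_mul_of_nonneg_left h2 (show 0 ≤ 4 * (m : ℝ) ^ 2 by positivity)]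
  -- The dissipation falls short of `x²` by the power `2 - 4 γ`, positive exactly because `γ < 1/2`.
  have hpow : (x ^ 4) ^ γ = x ^ (-(2 - 4 * γ)) * x ^ 2 := by
    rw [← Real.rpow_natCast, ← Real.rpow_natCast, ← Real.rpow_mul hx0.le, ← Real.rpow_add hx0]
    congr 1
    push_cast
    ring
  calc κ * symbolFracLaplacian γ (mode m j n) ≤ κ * (A * x ^ 4) ^ γ := by
        rw [symbolFracLaplacian]
        have := normSq_nonneg (mode m j n)
        have := hγ.1.le
        gcongr
    _ = κ * A ^ γ * x ^ (-(2 - 4 * γ)) * x ^ 2 := by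
        rw [Real.mul_rpow hApos.le (by positivity), hpow]
        ring
    _ ≤ B * x ^ 2 := by gcongr

lemma tendsto_exp_growth {s : ℝ} (hs : 0 < s) :
    Tendsto (fun j : ℕ => Real.exp (s * ((j : ℝ) + 1) ^ 2) * Real.exp (-((j : ℝ) + 1)))
      atTop atTop := by
  have hx : Tendsto (fun j : ℕ => (j : ℝ) + 1) atTop atTop :=
    tendsto_atTop_add_const_right _ _ tendsto_natCast_atTop_atTop
  refine tendsto_atTop_mono' _ ?_ (Real.tendsto_exp_atTop.comp hx)
  filter_upwards [hx.eventually_ge_atTop (2 / s)] with j hj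
  rw [← Real.exp_add, Function.comp_apply]
  rw [div_le_iff₀ hs] at hj
  have : (0 : ℝ) ≤ (j : ℝ) + 1 := by positivity
  exact Real.exp_le_exp.2 (by nlinarith)

end Asymptotics

end MG

/-! ### Conclusion -/

theorem mainTheorem2
    (Ω β η κ γ a : ℝ) (m : ℕ)
    (hΩ : 0 < Ω) (hβ : 0 < β) (hη : 0 < η) (hκ : 0 < κ)
    (hγ : γ ∈ Set.Ioo (0 : ℝ) (1 / 2)) (ha : 0 < a) (hm : 1 ≤ m)
    {X Y : Type*} [NormedAddCommGroup X] [NormedSpace ℝ X] [CompleteSpace X]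
    [NormedAddCommGroup Y] [NormedSpace ℝ Y] [CompleteSpace Y]
    (J : X →L[ℝ] MG.W14) (hJ : Function.Injective J)
    (i : Y →L[ℝ] X) (hi : Function.Injective i)
    (hsmooth : ∀ f : MG.W14, MG.IsSmooth (MG.W14.fn f) → MG.HasZeroVerticalMean (MG.W14.fn f) →
      ∃ y : Y, J (i y) = f) :
    ¬ MG.LocallyLipschitzWellPosed Ω β η κ γ
        (fun _ => MG.sinProfile (κ * a * (m : ℝ) ^ (2 * γ)) m) J i := by
  open MG Filter Topology in
  intro hwp
  have hm' : (0 : ℝ) < m := by exact_mod_cast hm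
  set b : ℝ := β ^ 2 / η with hb
  have hbpos : 0 < b := by positivity
  set c : ℝ := a * m / 2 with hc
  have hcpos : 0 < c := by positivity
  set D : ℝ := 16 * Ω ^ 2 * (m : ℝ) ^ 2 * (1 + 4 * (m : ℝ) ^ 2) + b ^ 2 with hD
  have hDpos : 0 < D := by positivity
  -- The coupling on the modes 1 and 2 is at least `2 s x²`: one half is the growth rate, the other
  -- pays for the dissipation.
  set s : ℝ := c * (b / D) / 2 with hs
  have hspos : 0 < s := by positivity
  -- The bound `M n ≤ const * x² / n²` and the rate `s x²` scale alike in `x`, so the decay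
  -- threshold `n₀` is the same in all sectors and one datum serves them all.
  obtain ⟨n₀, hn₀⟩ := exists_nat_ge (max 1 (6 * D / (4 * Ω ^ 2 * (m : ℝ) ^ 2)))
  have hn₀1 : 1 ≤ n₀ := by exact_mod_cast (le_max_left _ _).trans hn₀
  obtain ⟨θ₀, hθ₀s, hθ₀z, hθ₀⟩ := exists_steady a hm
  obtain ⟨f, hfs, hfz, hf⟩ := exists_datum hm n₀
  obtain ⟨y₀, hy₀⟩ := hsmooth θ₀ hθ₀s hθ₀z
  obtain ⟨y, hy⟩ := hsmooth f hfs hfz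
  obtain ⟨τ, hτ, V, hV, hsol⟩ := hwp.exists_approx_linearized hΩ hβ hη hm y₀ y (by rwa [hy₀])
  rw [hy] at hsol
  -- The sector is chosen last, after `τ` and `V`.
  obtain ⟨j, hj1, hj2⟩ := ((eventually_dissipation_le hκ hγ hspos m).and
    ((tendsto_exp_growth (mul_pos hspos hτ)).eventually_gt_atTop (2 * V))).exists
  set x : ℝ := (j : ℝ) + 1 with hx
  have hx0 : 0 < x := by positivity
  set M : ℕ → ℝ := fun n => symbolM Ω β η 2 (mode m j n) with hM
  set δ : ℕ → ℝ := fun n => κ * symbolFracLaplacian γ (mode m j n) with hδ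
  have hMlow : ∀ n, 1 ≤ n → n ≤ 2 → 2 * (s * x ^ 2) ≤ c * M n := fun n h1 h2 => by
    have h := mul_le_mul_of_nonneg_left (le_symbolM_mode hΩ hβ hη hm h1 h2 j) hcpos.le
    refine le_trans (le_of_eq ?_) h
    rw [hs]
    ring
  have hMup : ∀ n, 1 ≤ n → M n ≤ b * x ^ 2 / (4 * Ω ^ 2 * (m : ℝ) ^ 2) * (1 / (n : ℝ) ^ 2) :=
    fun n hn => symbolM_mode_le hΩ hη hm hn j
  have hMmax : ∀ n, M n ≤ b * x ^ 2 / (4 * Ω ^ 2 * (m : ℝ) ^ 2) := by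
    intro n
    rcases Nat.eq_zero_or_pos n with rfl | hn
    · rw [hM]
      simp only [symbolM_mode_zero]
      positivity
    · have : (1 : ℝ) ≤ (n : ℝ) ^ 2 := one_le_pow₀ (by exact_mod_cast hn)
      exact (hMup n hn).trans (mul_le_of_le_one_right (by positivity)
        ((div_le_one (by positivity)).2 this))
  obtain ⟨σ, hσ, r, hr0, hr, heig, hdec⟩ := exists_eigenvector (M := M) (δ := δ) (c := c)
    (σ₀ := s * x ^ 2) (n₀ := n₀) hcpos
    (fun n hn => by
      simp only [hM]
      rw [symbolM_mode hm hn]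
      have : (0 : ℝ) < n := by exact_mod_cast hn
      positivity)
    hMmax
    (fun n => mul_nonneg hκ.le (Real.rpow_nonneg (normSq_nonneg _) _))
    (by positivity)
    (by linarith [hMlow 1 le_rfl one_le_two, hj1 1 one_le_two])
    (by linarith [hMlow 2 one_le_two le_rfl, hj1 2 le_rfl])
    (fun n hn => by
      have hn1 : (1 : ℝ) ≤ n := by exact_mod_cast hn₀1.trans hn.le
      have hn2 : 6 * D / (4 * Ω ^ 2 * (m : ℝ) ^ 2) ≤ (n : ℝ) ^ 2 := by
        have h1 : (n₀ : ℝ) ≤ n := by exact_mod_cast hn.le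
        nlinarith [(le_max_right (1 : ℝ) _).trans hn₀]
      have hn3 : 0 < (n : ℝ) ^ 2 := by positivity
      rw [div_le_iff₀ (by positivity)] at hn2
      calc 3 * (c * M n)
          ≤ 3 * (c * (b * x ^ 2 / (4 * Ω ^ 2 * (m : ℝ) ^ 2) * (1 / (n : ℝ) ^ 2))) := by
            gcongr
            exact hMup n (hn₀1.trans hn.le)
        _ = c * b * x ^ 2 * (3 / ((n : ℝ) ^ 2 * (4 * Ω ^ 2 * (m : ℝ) ^ 2))) := by
            field_simp
        _ ≤ c * b * x ^ 2 * (1 / (2 * D)) := by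
            refine mul_le_mul_of_nonneg_left ?_ (by positivity)
            rw [div_le_div_iff₀ (by positivity) (by positivity)]
            linarith
        _ = s * x ^ 2 := by rw [hs]; field_simp)
  have hσpos : 0 < σ := lt_of_lt_of_le (by positivity) hσ
  have key := exp_mul_le_of_approx (M := M) (δ := δ) (r := r) (c := c) (τ := τ) (V := V)
    (w := Real.exp (-x)) (p := fun n => fc (W14.fn f) (mode m j n)) hn₀1 hcpos hσpos hτ.le
    (Real.exp_pos _).le hV (symbolM_mode_zero Ω β η m j) (symbolM_mode_nonneg hη hm j)
    (tendsto_symbolM_mode hΩ hη hm j) hr0 hr heig hdec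
    (fun n hn => by
      rw [hf, if_pos hn])
    (fun n hn => by
      rw [hf, if_neg (not_lt.2 hn)])
    (fun E hE => by
      obtain ⟨v, e, hv, he, h⟩ := hsol E hE
      refine ⟨fun n => v (mode m j n), fun n => e (mode m j (n + 1)), fun n => hv _, fun n => he _,
        fun n t ht => ⟨(h _ t ht).1, (h _ t ht).2.1, ?_⟩⟩
      have h1 := (h (mode m j (n + 1)) t ht).2.2
      rw [mode_succ_sub, mode_succ_add] at h1
      exact h1)
  have hexp : Real.exp (s * τ * x ^ 2) ≤ Real.exp (σ * τ) := by
    refine Real.exp_le_exp.2 ?_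
    calc s * τ * x ^ 2 = s * x ^ 2 * τ := by ring
      _ ≤ σ * τ := by gcongr
  have := mul_le_mul_of_nonneg_right hexp (Real.exp_pos (-x)).le
  linarith
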